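/- Let $\mathbb K$ be an algebraically closed field of characteristic different from $2$ and let $n\ge 1$. A general $(n+1)$-lateral in $\mathbb P^2=\mathbb P^2_{\mathbb K}$ is a union of $n+1$ distinct lines (its sides), no three of which are concurrent, i.e. whose only singular points are $\binom{n+1}{2}$ nodes (its vertices). It is inscribed in a curve $C$ if $C$ passes through all its vertices, and it is circumscribed about an irreducible conic $\Gamma$ if all its sides are tangent to $\Gamma$. Plane curves of degree $d$ (possibly reducible or non-reduced) are regarded as points of the projective space of ternary forms of degree $d$, with its Zariski topology. **Theorem.** Let $C$ be a plane curve of degree $n$, and suppose that some general $(n+1)$-lateral $L$ is inscribed in $C$ and circumscribed about an irreducible conic $\Gamma$. Then there is a $1$-dimensional family $\mathcal F$ of general $(n+1)$-laterals (an irreducible, locally closed, $1$-dimensional subset of the projective space of plane curves of degree $n+1$), all inscribed in $C$ and circumscribed about $\Gamma$, such that 1. all but finitely many points of $C$ are vertices of some $(n+1)$-lateral in $\mathcal F$; 2. every point $p$ of $C$ is a vertex of a possibly degenerate $(n+1)$-lateral in the closure $\overline{\mathcal F}$: there is $M\in\overline{\mathcal F}$ such that either $p$ lies on two distinct lines contained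 in $M$, or $p$ is the point of contact with $\Gamma$ of a tangent line of $\Gamma$ contained in $M$ with multiplicity at least $2$. -/

import Mathlib

open scoped LinearAlgebra.Projectivization

namespace Darboux

variable (K : Type*) [Field K]

/-- The projective plane over `K`. -/
abbrev Point : Type _ := ℙ K (Fin 3 → K)

/-- The dual projective plane: `[a₀ : a₁ : a₂]` stands for the line `a₀x₀ + a₁x₁ + a₂x₂ = 0`. -/
abbrev Line : Type _ := ℙ K (Fin 3 → K)

/-- Plane curves of degree `d`, possibly reducible or non-reduced: nonzero ternary forms of
degree `d` up to nonzero scalars. -/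
def PlaneCurve (d : ℕ) : Type _ := ℙ K (MvPolynomial.homogeneousSubmodule (Fin 3) K d)

variable {K}

/-- An equation of the curve (well defined up to a nonzero scalar). -/
noncomputable def PlaneCurve.eqn {d : ℕ} (C : PlaneCurve K d) : MvPolynomial (Fin 3) K :=
  (Projectivization.rep C : MvPolynomial.homogeneousSubmodule (Fin 3) K d)

/-- The points of the curve. -/
def PlaneCurve.points {d : ℕ} (C : PlaneCurve K d) : Set (Point K) :=
  {p | MvPolynomial.eval p.rep C.eqn = 0}

/-- The Zariski topology on the projective space of plane curves of degree `d`: the open sets are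
generated by the non-vanishing loci of homogeneous polynomials in the coefficients of the
equation. -/
instance PlaneCurve.zariskiTopology (d : ℕ) : TopologicalSpace (PlaneCurve K d) :=
  TopologicalSpace.generateFrom
    {U | ∃ (k : ℕ) (P : MvPolynomial (Fin 3 →₀ ℕ) K), P.IsHomogeneous k ∧
      U = {C : PlaneCurve K d | MvPolynomial.eval (fun m => MvPolynomial.coeff m C.eqn) P ≠ 0}}

/-- The point `p` lies on the line `l`. -/
def OnLine (p : Point K) (l : Line K) : Prop := Projectivization.orthogonal p l

/-- The linear form defining a line. -/
noncomputable def lineForm (l : Line K) : MvPolynomial (Fin 3) K :=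
  ∑ i, MvPolynomial.C (l.rep i) * MvPolynomial.X i

/-- The line `l` is tangent to `G` at the point `p`: `p` lies on `G` and the coordinates of `l` are
proportional to the (nonzero) gradient of the equation of `G` at `p`. -/
def IsTangentAt {d : ℕ} (l : Line K) (G : PlaneCurve K d) (p : Point K) : Prop :=
  p ∈ G.points ∧
    ∃ c : K, c ≠ 0 ∧ ∀ i, MvPolynomial.eval p.rep (MvPolynomial.pderiv i G.eqn) = c * l.rep i

/-- The line `l` is tangent to `G`. -/
def IsTangent {d : ℕ} (l : Line K) (G : PlaneCurve K d) : Prop := ∃ p, IsTangentAt l G p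

/-- `l` is a side of `L`, i.e. `L` contains the line `l`. -/
def IsSide {m : ℕ} (l : Line K) (L : PlaneCurve K m) : Prop := lineForm l ∣ L.eqn

/-- `L` is a general `m`-lateral: the union of `m` distinct lines, no three of them concurrent (so
that all its singular points are nodes). -/
def IsGeneralLateral {m : ℕ} (L : PlaneCurve K m) : Prop :=
  ∃ l : Fin m → Line K,
    Associated L.eqn (∏ i, lineForm (l i)) ∧ Function.Injective l ∧
      ∀ i j k, i ≠ j → i ≠ k → j ≠ k →
        ∀ p : Point K, ¬ (OnLine p (l i) ∧ OnLine p (l j) ∧ OnLine p (l k))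

/-- The vertices of `L`: the points that lie on two distinct sides. -/
def vertices {m : ℕ} (L : PlaneCurve K m) : Set (Point K) :=
  {p | ∃ l l' : Line K, l ≠ l' ∧ IsSide l L ∧ IsSide l' L ∧ OnLine p l ∧ OnLine p l'}

/-- `L` is inscribed in `C`: the curve `C` passes through all vertices of `L`. -/
def IsInscribedIn {m d : ℕ} (L : PlaneCurve K m) (C : PlaneCurve K d) : Prop :=
  vertices L ⊆ C.points

/-- `L` is circumscribed about `G`: all sides of `L` are tangent to `G`. -/
def IsCircumscribedAbout {m d : ℕ} (L : PlaneCurve K m) (G : PlaneCurve K d) : Prop :=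
  ∀ l : Line K, IsSide l L → IsTangent l G

/-- The vertices relative to `G` of a possibly degenerate lateral `L` with sides tangent to `G`:
besides the intersections of distinct sides, the points at which a multiple side touches `G`
(two sides that come together meet, in the limit, at the point of contact). -/
def limitVertices {m d : ℕ} (L : PlaneCurve K m) (G : PlaneCurve K d) : Set (Point K) :=
  vertices L ∪ {p | ∃ l : Line K, lineForm l ^ 2 ∣ L.eqn ∧ IsTangentAt l G p}

/-- A one-dimensional algebraic family of plane curves: an irreducible, locally closed subset of
dimension one of the projective space of curves of the given degree. -/
structure IsOneDimFamily {m : ℕ} (F : Set (PlaneCurve K m)) : Prop where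
  isLocallyClosed : IsLocallyClosed F
  isIrreducible : IsIrreducible F
  dim_eq_one : topologicalKrullDim F = 1

end Darboux

/-!
A smooth conic `Γ` parametrizes everything in sight. Its tangents form a projective line, and a
point of the plane is the same as an unordered pair of tangents, the two tangents through it (they
coincide for the points of `Γ`); this is `TangentParametrization`. In these coordinates

* a curve `C` of degree `n` is a symmetric form `G` of bidegree `(n, n)` on the projective line;
* a lateral with `n + 1` sides tangent to `Γ` is a binary form `f` of degree `n + 1`, its equation
  being `f ⊗ f`, its vertices the pairs of distinct zeros of `f` (`IsLateralOf`);
* the lateral is inscribed in `C` iff `G` vanishes at all pairs of distinct zeros of `f`.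

In the last case, if `f` has distinct zeros, then `[u, v] G(u, v)` vanishes at *all* pairs of zeros
of `f`, equal ones included, and as it is antisymmetric it equals `f(u) g(v) - f(v) g(u)` for some
form `g`: that is, `G` is a Bezoutian (`exists_bezoutian`). But then `G` vanishes at any two
distinct zeros of any member of the pencil spanned by `f` and `g`, so that the whole pencil consists of
laterals inscribed in `C`. The family is the set of members `f + x g` without multiple zeros.

The equation of the lateral of `x f + y g` is quadratic in `(x, y)`, so that the pencil is embedded
as a conic in a plane in the space of curves (`exists_pencil`); it is closed, and the induced
topology is the cofinite one, whence the dimension. Only finitely many members have multiple zeros,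
as these are zeros of the nonzero form `G(u, u)`, and a given point is a multiple zero of at most
one of the members `f + x g` (`finite_setOf_hasDoubleZero`).

If `pt s u` is a point of `C` then `f(s) g(u) = f(u) g(s)`, so some member of the pencil vanishes at
both `s` and `u`; if `s = u` it can be chosen with a multiple zero at `s` (`exists_hasDoubleZero`).
This gives a lateral in the closure of the family that has the point as a (limit) vertex, and a
lateral in the family itself unless the point is on `C ∩ Γ` or is a vertex of one of the finitely
many laterals left out.
-/

namespace Darboux

/-! ### Binary forms -/

section BinaryForms

variable {K : Type*} [Field K]

lemma eval_smul_of_isHomogeneous {σ : Type*} {P : MvPolynomial σ K} {d : ℕ} (hP : P.IsHomogeneous d)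
    (c : K) (x : σ → K) :
    MvPolynomial.eval (c • x) P = c ^ d * MvPolynomial.eval x P := by
  rw [MvPolynomial.eval_eq, MvPolynomial.eval_eq, Finset.mul_sum]
  refine Finset.sum_congr rfl fun m hm => ?_
  have hd : ∑ i ∈ m.support, m i = d := by
    rw [← hP (MvPolynomial.mem_support_iff.mp hm), Finsupp.weight_apply, Finsupp.sum]
    simp
  simp only [Pi.smul_apply, smul_eq_mul, mul_pow, Finset.prod_mul_distrib,
    Finset.prod_pow_eq_pow_sum, hd]
  ring

/-- The determinant of two vectors of `K²`; it vanishes iff they are proportional. -/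
def bracket (s t : Fin 2 → K) : K := s 0 * t 1 - s 1 * t 0

lemma bracket_self (s : Fin 2 → K) : bracket s s = 0 := by simp [bracket, mul_comm]

lemma bracket_swap (s t : Fin 2 → K) : bracket s t = - bracket t s := by simp only [bracket]; ring

lemma bracket_smul_left (c : K) (s t : Fin 2 → K) : bracket (c • s) t = c * bracket s t := by
  simp [bracket]; ring

lemma exists_smul_of_bracket_eq_zero {s t : Fin 2 → K} (hs : s ≠ 0) (h : bracket s t = 0) :
    ∃ c : K, t = c • s := by
  unfold bracket at h
  by_cases h0 : s 0 = 0
  · have h1 : s 1 ≠ 0 := fun h1 => hs (by ext i; fin_cases i <;> simp [h0, h1])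
    refine ⟨t 1 / s 1, ?_⟩
    have : t 0 = 0 := by simpa [h0, h1] using h
    ext i; fin_cases i <;> simp [h0, h1, this]
  · refine ⟨t 0 / s 0, ?_⟩
    ext i; fin_cases i
    · simp [h0]
    · simp only [Fin.mk_one, Pi.smul_apply, smul_eq_mul]
      field_simp
      linear_combination h

lemma bracket_eq_zero_trans {r s t : Fin 2 → K} (hs : s ≠ 0) (h₁ : bracket s r = 0)
    (h₂ : bracket s t = 0) : bracket r t = 0 := by
  obtain ⟨c, rfl⟩ := exists_smul_of_bracket_eq_zero hs h₁
  rw [bracket_smul_left, h₂, mul_zero]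

lemma exists_bracket_ne_zero {s : Fin 2 → K} (hs : s ≠ 0) : ∃ t, bracket s t ≠ 0 := by
  by_contra! h
  apply hs
  have h0 := h ![0, 1]
  have h1 := h ![1, 0]
  simp [bracket] at h0 h1
  ext i; fin_cases i <;> simp [h0, h1]

/-- A function on `K²` given by a binary form of degree `d`. -/
def IsBinaryForm (d : ℕ) (φ : (Fin 2 → K) → K) : Prop :=
  ∃ P : MvPolynomial (Fin 2) K, P.IsHomogeneous d ∧ ∀ s, MvPolynomial.eval s P = φ s

namespace IsBinaryForm

variable {d e : ℕ} {φ ψ : (Fin 2 → K) → K}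

lemma zero (d : ℕ) : IsBinaryForm d (fun _ => (0 : K)) :=
  ⟨0, MvPolynomial.isHomogeneous_zero _ _ _, by simp⟩

lemma add (hφ : IsBinaryForm d φ) (hψ : IsBinaryForm d ψ) :
    IsBinaryForm d (fun s => φ s + ψ s) := by
  obtain ⟨P, hP, h⟩ := hφ
  obtain ⟨Q, hQ, h'⟩ := hψ
  exact ⟨P + Q, hP.add hQ, by simp [h, h']⟩

lemma const_mul (c : K) (hφ : IsBinaryForm d φ) : IsBinaryForm d (fun s => c * φ s) := by
  obtain ⟨P, hP, h⟩ := hφ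
  refine ⟨MvPolynomial.C c * P, ?_, by simp [h]⟩
  simpa using (MvPolynomial.isHomogeneous_C (Fin 2) c).mul hP

lemma sub (hφ : IsBinaryForm d φ) (hψ : IsBinaryForm d ψ) :
    IsBinaryForm d (fun s => φ s - ψ s) := by
  simpa [sub_eq_add_neg] using hφ.add (hψ.const_mul (-1))

lemma mul (hφ : IsBinaryForm d φ) (hψ : IsBinaryForm e ψ) :
    IsBinaryForm (d + e) (fun s => φ s * ψ s) := by
  obtain ⟨P, hP, h⟩ := hφ
  obtain ⟨Q, hQ, h'⟩ := hψ
  exact ⟨P * Q, hP.mul hQ, by simp [h, h']⟩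

lemma prod {m : ℕ} {φ : Fin m → (Fin 2 → K) → K} (h : ∀ i, IsBinaryForm 1 (φ i)) :
    IsBinaryForm m (fun s => ∏ i, φ i s) := by
  choose P hP h using h
  refine ⟨∏ i, P i, ?_, fun s => by simp [h]⟩
  simpa using MvPolynomial.IsHomogeneous.prod Finset.univ P (fun _ => 1) (fun i _ => hP i)

lemma linear (a b : K) : IsBinaryForm 1 (fun s => a * s 0 + b * s 1) := by
  refine ⟨MvPolynomial.C a * MvPolynomial.X 0 + MvPolynomial.C b * MvPolynomial.X 1, ?_, by simp⟩
  have h := fun (c : K) (i : Fin 2) =>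
    (MvPolynomial.isHomogeneous_C (Fin 2) c).mul (MvPolynomial.isHomogeneous_X K i)
  simpa using (h a 0).add (h b 1)

lemma bracket_left (a : Fin 2 → K) : IsBinaryForm 1 (fun s => bracket a s) := by
  have := linear (-a 1) (a 0)
  convert this using 2
  simp only [bracket]; ring

lemma map_smul (hφ : IsBinaryForm d φ) (c : K) (s : Fin 2 → K) : φ (c • s) = c ^ d * φ s := by
  obtain ⟨P, hP, h⟩ := hφ
  rw [← h, ← h, eval_smul_of_isHomogeneous hP]

/-- Substituting binary forms of degree `k` into a ternary form. -/
lemma comp_forms {k : ℕ} {Q : MvPolynomial (Fin 3) K} (hQ : Q.IsHomogeneous d)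
    {v : (Fin 2 → K) → Fin 3 → K} (hv : ∀ i, IsBinaryForm k (fun s => v s i)) :
    IsBinaryForm (k * d) (fun s => MvPolynomial.eval (v s) Q) := by
  choose P hP h using hv
  refine ⟨MvPolynomial.aeval P Q, hQ.aeval P hP, fun s => ?_⟩
  rw [← MvPolynomial.bind₁, MvPolynomial.eval, MvPolynomial.eval₂Hom_bind₁]
  have hs : (fun i => MvPolynomial.eval₂Hom (RingHom.id K) s (P i)) = v s := funext fun i => h i s
  rw [hs]
  rfl

end IsBinaryForm

open Polynomial in
lemma exists_factorization_homogenize [IsAlgClosed K] (d : ℕ) :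
    ∀ q : K[X], q ≠ 0 → q.natDegree ≤ d → ∃ c : K, c ≠ 0 ∧ ∃ t : Fin d → Fin 2 → K,
      (∀ i, t i ≠ 0) ∧
        ∀ s, MvPolynomial.eval s (q.homogenize d) = c * ∏ i, bracket (t i) s := by
  induction d with
  | zero =>
    intro q hq hd
    obtain ⟨c, rfl⟩ := Polynomial.natDegree_eq_zero.mp (Nat.le_zero.mp hd)
    exact ⟨c, by simpa using hq, Fin.elim0, fun i => i.elim0, by simp⟩
  | succ d ih =>
    intro q hq hd
    -- a polynomial of degree less than `d + 1` has the root `[1 : 0]` at infinity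
    obtain ⟨l, q', t₀, hl, hq', hd', h⟩ : ∃ (l q' : K[X]) (t₀ : Fin 2 → K), t₀ ≠ 0 ∧ q = l * q' ∧
        q'.natDegree ≤ d ∧ l.natDegree ≤ 1 ∧
          ∀ s, MvPolynomial.eval s (l.homogenize 1) = bracket t₀ s := by
      rcases Nat.lt_or_ge d q.natDegree with h | h
      · obtain ⟨r, hr⟩ := IsAlgClosed.exists_root q
          (fun h' => by
            rw [natDegree_eq_of_degree_eq_some h'] at h
            exact absurd h (Nat.not_lt_zero _))
        obtain ⟨q', rfl⟩ := dvd_iff_isRoot.mpr hr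
        have hq' : q' ≠ 0 := right_ne_zero_of_mul hq
        rw [natDegree_mul (X_sub_C_ne_zero r) hq', natDegree_X_sub_C] at hd
        refine ⟨X - C r, q', ![-r, -1], ?_, rfl, by omega, by simp, ?_⟩
        · intro h; simpa using congrFun h 1
        · intro s
          rw [homogenize_sub, homogenize_X one_ne_zero, homogenize_C]
          simp [bracket]; ring
      · refine ⟨1, q, ![1, 0], ?_, by simp, h, by simp, ?_⟩
        · intro h; simpa using congrFun h 0
        · intro s; simp [bracket]
    obtain ⟨c, hc, t, ht, H⟩ := ih q' (by rintro rfl; simp at hq'; exact hq hq') hd'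
    refine ⟨c, hc, Fin.cons t₀ t, Fin.cases hl ht, fun s => ?_⟩
    have hmul := homogenize_mul q' l hd' h.1
    rw [hq', mul_comm, hmul, map_mul, h.2, H, Fin.prod_univ_succ]
    simp; ring

namespace IsBinaryForm

variable {d e : ℕ} {φ ψ : (Fin 2 → K) → K}

/-- A nonzero binary form over an algebraically closed field is a product of linear forms. -/
lemma exists_factorization [IsAlgClosed K] (hφ : IsBinaryForm d φ) (h0 : ∃ s, φ s ≠ 0) :
    ∃ c : K, c ≠ 0 ∧ ∃ t : Fin d → Fin 2 → K, (∀ i, t i ≠ 0) ∧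
      ∀ s, φ s = c * ∏ i, bracket (t i) s := by
  obtain ⟨P, hP, h⟩ := hφ
  have hq := Polynomial.homogenize_eq_of_isHomogeneous (q := P) hP rfl
  have hdeg : (MvPolynomial.aeval ![Polynomial.X, 1] P : Polynomial K).natDegree ≤ d := by
    simpa using MvPolynomial.aeval_natDegree_le (n := 1) P hP.totalDegree_le ![Polynomial.X, 1]
      (fun i => by fin_cases i <;> simp)
  obtain ⟨c, hc, t, ht, H⟩ := exists_factorization_homogenize d _ (fun h' => by
    rw [h', Polynomial.homogenize_zero] at hq
    obtain ⟨s, hs⟩ := h0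
    rw [← h, ← hq] at hs
    simp at hs) hdeg
  exact ⟨c, hc, t, ht, fun s => by rw [← h, ← H, hq]⟩

/-- A binary form of degree `d` with more than `d` zeros in the projective line vanishes. -/
lemma eq_zero_of_zeros [IsAlgClosed K] {ι : Type*} [Fintype ι] (hφ : IsBinaryForm d φ)
    (hd : d < Fintype.card ι) (a : ι → Fin 2 → K)
    (ha : ∀ i j, i ≠ j → bracket (a i) (a j) ≠ 0) (h : ∀ i, φ (a i) = 0) (s : Fin 2 → K) :
    φ s = 0 := by
  by_contra hs
  obtain ⟨c, hc, t, ht, H⟩ := hφ.exists_factorization ⟨s, hs⟩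
  have : ∀ i, ∃ k, bracket (t k) (a i) = 0 := fun i => by
    have := h i
    rw [H] at this
    simpa [hc, Finset.prod_eq_zero_iff] using this
  choose k hk using this
  obtain ⟨i, j, hij, hkij⟩ := Fintype.exists_ne_map_eq_of_card_lt k (by simpa using hd)
  exact ha i j hij (bracket_eq_zero_trans (ht (k i)) (hk i) (hkij ▸ hk j))

lemma exists_eq_bracket_mul [IsAlgClosed K] (hφ : IsBinaryForm (d + 1) φ) {a : Fin 2 → K}
    (ha : a ≠ 0) (h : φ a = 0) :
    ∃ ψ, IsBinaryForm d ψ ∧ ∀ s, φ s = bracket a s * ψ s := by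
  by_cases h0 : ∃ s, φ s ≠ 0
  · obtain ⟨c, hc, t, ht, H⟩ := hφ.exists_factorization h0
    obtain ⟨k, hk⟩ : ∃ k, bracket (t k) a = 0 := by
      rw [H] at h
      simpa [hc, Finset.prod_eq_zero_iff] using h
    obtain ⟨e, he⟩ := exists_smul_of_bracket_eq_zero ha (t := t k)
      (by rw [bracket_swap, hk, neg_zero])
    refine ⟨_, (prod fun i => bracket_left (t (k.succAbove i))).const_mul (c * e), fun s => ?_⟩
    rw [H, Fin.prod_univ_succAbove _ k, he, bracket_smul_left]
    ring
  · push Not at h0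
    exact ⟨_, zero d, by simp [h0]⟩

end IsBinaryForm

end BinaryForms

/-! ### The cofinite topology on a curve -/

section CofiniteCurves

/-- An infinite `T₁` space whose proper closed subsets are all finite has dimension one. -/
lemma topologicalKrullDim_eq_one_of_finite {X : Type*} [TopologicalSpace X] [T1Space X] [Infinite X]
    (h : ∀ Z : Set X, IsClosed Z → Z ≠ Set.univ → Z.Finite) : topologicalKrullDim X = 1 := by
  have hsub : ∀ Z : TopologicalSpace.IrreducibleCloseds X, (Z : Set X) ≠ Set.univ →
      (Z : Set X).Subsingleton := fun Z hZ => by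
    have hd : IsDiscrete (Z : Set X) := (h Z Z.isClosed hZ).isDiscrete
    exact hd.subsingleton_of_isPreirreducible Z.isIrreducible.isPreirreducible
  have huniv : IsIrreducible (Set.univ : Set X) := by
    refine ⟨Set.univ_nonempty, fun u v hu hv hu' hv' => ?_⟩
    by_contra hne
    have hfin : ∀ w : Set X, IsOpen w → (Set.univ ∩ w).Nonempty → wᶜ.Finite :=
      fun w hw hw' => h _ hw.isClosed_compl fun hc => by
        rw [Set.compl_univ_iff] at hc
        simp [hc] at hw'
    have hcompl : uᶜ ∪ vᶜ = Set.univ := by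
      rw [← Set.compl_inter, Set.compl_univ_iff]
      simpa [Set.not_nonempty_iff_eq_empty] using hne
    exact Set.infinite_univ (hcompl ▸ (hfin u hu hu').union (hfin v hv hv'))
  apply le_antisymm
  · refine Order.krullDim_le_one_iff.mpr fun Z => ?_
    by_cases hZ : (Z : Set X) = Set.univ
    · exact Or.inr fun W _ => by
        change (W : Set X) ⊆ Z
        rw [hZ]; exact Set.subset_univ _
    · refine Or.inl fun W hW => ?_
      change (Z : Set X) ⊆ W
      intro x hx
      obtain ⟨y, hy⟩ := W.isIrreducible.nonempty
      rwa [hsub Z hZ hx (hW hy)]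
  · refine Order.one_le_krullDim_iff.mpr ?_
    obtain ⟨x⟩ : Nonempty X := inferInstance
    refine ⟨⟨{x}, isIrreducible_singleton, isClosed_singleton⟩, ⟨Set.univ, huniv, isClosed_univ⟩,
      ?_⟩
    rw [← SetLike.coe_ssubset_coe]
    refine Set.ssubset_univ_iff.mpr fun hx => ?_
    have hfin : (Set.univ : Set X).Finite := by
      rw [← show ({x} : Set X) = Set.univ from hx]; exact Set.finite_singleton x
    exact Set.infinite_univ hfin

variable {T X : Type*} [Infinite T] [TopologicalSpace X] {γ : CofiniteTopology T → X}
  {B : Set (CofiniteTopology T)}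

lemma isIrreducible_image_compl (hγ : Continuous γ) (hB : B.Finite) :
    IsIrreducible (γ '' Bᶜ) := by
  refine IsIrreducible.image ⟨hB.infinite_compl.nonempty, ?_⟩ γ hγ.continuousOn
  refine (PreirreducibleSpace.isPreirreducible_univ).open_subset ?_ (Set.subset_univ _)
  exact CofiniteTopology.isOpen_iff.mpr fun _ => by rwa [compl_compl]

lemma mem_closure_image_compl (hγ : Continuous γ) (hB : B.Finite) (x : CofiniteTopology T) :
    γ x ∈ closure (γ '' Bᶜ) := by
  apply image_closure_subset_closure_image hγ
  refine Set.mem_image_of_mem _ ?_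
  have : closure Bᶜ = Set.univ :=
    (CofiniteTopology.isClosed_iff.mp isClosed_closure).resolve_right fun h =>
      hB.infinite_compl (h.subset subset_closure)
  simp [this]

lemma topologicalKrullDim_image_compl [T1Space X] (hγ : Continuous γ) (hinj : Function.Injective γ)
    (hB : B.Finite) : topologicalKrullDim (γ '' Bᶜ) = 1 := by
  have : Infinite (γ '' Bᶜ) := (hB.infinite_compl.image hinj.injOn).to_subtype
  refine topologicalKrullDim_eq_one_of_finite fun Z hZ hne => ?_
  obtain ⟨W, hW, rfl⟩ := isClosed_induced_iff.mp hZ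
  rcases CofiniteTopology.isClosed_iff.mp (hW.preimage hγ) with h | h
  · refine absurd (Set.eq_univ_iff_forall.mpr ?_) hne
    rintro ⟨_, x, -, rfl⟩
    exact Set.eq_univ_iff_forall.mp h x
  · refine Set.Finite.of_finite_image ((h.image γ).subset ?_) Subtype.val_injective.injOn
    rintro _ ⟨⟨_, x, hxB, rfl⟩, hx, rfl⟩
    exact ⟨x, hx, rfl⟩

end CofiniteCurves

/-! ### The Zariski topology on the space of plane curves -/

section CurveSpace

variable {K : Type*} [Field K] {d : ℕ}

namespace PlaneCurve

/-- The plane curve with a given nonzero equation. -/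
noncomputable def ofForm (v : MvPolynomial.homogeneousSubmodule (Fin 3) K d) (hv : v ≠ 0) :
    PlaneCurve K d :=
  Projectivization.mk K v hv

lemma eqn_isHomogeneous (C : PlaneCurve K d) : C.eqn.IsHomogeneous d :=
  (MvPolynomial.mem_homogeneousSubmodule d _).mp (Projectivization.rep C).2

lemma eqn_ne_zero (C : PlaneCurve K d) : C.eqn ≠ 0 := fun h =>
  Projectivization.rep_nonzero C (Subtype.ext h)

lemma exists_eqn_ofForm (v : MvPolynomial.homogeneousSubmodule (Fin 3) K d) (hv : v ≠ 0) :
    ∃ a : K, a ≠ 0 ∧ (ofForm v hv).eqn = a • (v : MvPolynomial (Fin 3) K) := by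
  obtain ⟨a, ha⟩ := Projectivization.exists_smul_eq_mk_rep K v hv
  exact ⟨a, a.ne_zero, (congrArg Subtype.val ha).symm⟩

lemma eq_ofForm {C : PlaneCurve K d} {v : MvPolynomial.homogeneousSubmodule (Fin 3) K d}
    (hv : v ≠ 0) {a : K} (h : C.eqn = a • (v : MvPolynomial (Fin 3) K)) : C = ofForm v hv := by
  refine (Projectivization.mk_rep C).symm.trans ?_
  exact (Projectivization.mk_eq_mk_iff' K _ _ _ _).mpr ⟨a, Subtype.ext h.symm⟩

lemma isClosed_setOf_eval_coeff {k : ℕ} {P : MvPolynomial (Fin 3 →₀ ℕ) K}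
    (hP : P.IsHomogeneous k) :
    IsClosed {C : PlaneCurve K d |
      MvPolynomial.eval (fun m => MvPolynomial.coeff m C.eqn) P = 0} := by
  refine ⟨TopologicalSpace.isOpen_generateFrom_of_mem ⟨k, P, hP, ?_⟩⟩
  ext C; simp

/-- A linear functional on forms of degree `d` is a linear form in the coefficients. -/
lemma exists_isHomogeneous_eval_coeff (d : ℕ) (l : MvPolynomial (Fin 3) K →ₗ[K] K) :
    ∃ P : MvPolynomial (Fin 3 →₀ ℕ) K, P.IsHomogeneous 1 ∧
      ∀ p : MvPolynomial (Fin 3) K, p.IsHomogeneous d →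
        MvPolynomial.eval (fun m => MvPolynomial.coeff m p) P = l p := by
  refine ⟨∑ m ∈ Finset.finsuppAntidiag Finset.univ d,
    MvPolynomial.C (l (MvPolynomial.monomial m 1)) * MvPolynomial.X m, ?_, fun p hp => ?_⟩
  · refine MvPolynomial.IsHomogeneous.sum _ _ _ fun m _ => ?_
    simpa using (MvPolynomial.isHomogeneous_C _ _).mul (MvPolynomial.isHomogeneous_X K m)
  · have hs : p.support ⊆ Finset.finsuppAntidiag Finset.univ d := fun m hm => by
      have := hp (MvPolynomial.mem_support_iff.mp hm)
      rw [Finsupp.weight_apply, Finsupp.sum_fintype _ _ (by simp)] at this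
      simpa [Finset.mem_finsuppAntidiag] using this
    conv_rhs => rw [p.as_sum, map_sum]
    rw [map_sum, ← Finset.sum_subset hs]
    · refine Finset.sum_congr rfl fun m _ => ?_
      rw [← mul_one (MvPolynomial.coeff m p), ← smul_eq_mul (MvPolynomial.coeff m p),
        ← MvPolynomial.smul_monomial, map_smul]
      simp [mul_comm]
    · intro m _ hm
      simp [MvPolynomial.notMem_support_iff.mp hm]

lemma isClosed_setOf_linear (l : MvPolynomial (Fin 3) K →ₗ[K] K) :
    IsClosed {C : PlaneCurve K d | l C.eqn = 0} := by
  obtain ⟨P, hP, h⟩ := exists_isHomogeneous_eval_coeff d l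
  convert isClosed_setOf_eval_coeff (d := d) hP using 3 with C
  rw [h _ C.eqn_isHomogeneous]

lemma isClosed_setOf_mul_eq_sq (l₀ l₁ l₂ : MvPolynomial (Fin 3) K →ₗ[K] K) :
    IsClosed {C : PlaneCurve K d | l₀ C.eqn * l₂ C.eqn = l₁ C.eqn ^ 2} := by
  obtain ⟨P₀, hP₀, h₀⟩ := exists_isHomogeneous_eval_coeff d l₀
  obtain ⟨P₁, hP₁, h₁⟩ := exists_isHomogeneous_eval_coeff d l₁
  obtain ⟨P₂, hP₂, h₂⟩ := exists_isHomogeneous_eval_coeff d l₂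
  convert isClosed_setOf_eval_coeff (d := d) ((hP₀.mul hP₂).sub (hP₁.pow 2)) using 3 with C
  simp [h₀ _ C.eqn_isHomogeneous, h₁ _ C.eqn_isHomogeneous, h₂ _ C.eqn_isHomogeneous, sub_eq_zero]

instance : T1Space (PlaneCurve K d) := by
  refine ⟨fun D => ?_⟩
  -- proportionality of the coefficients is the vanishing of their `2 × 2` minors
  have : ({D} : Set (PlaneCurve K d)) = ⋂ (m : Fin 3 →₀ ℕ) (m' : Fin 3 →₀ ℕ), {C : PlaneCurve K d |
      (D.eqn.coeff m • MvPolynomial.lcoeff K m' - D.eqn.coeff m' • MvPolynomial.lcoeff K m) C.eqn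
        = 0} := by
    ext C
    simp only [Set.mem_singleton_iff, Set.mem_iInter, Set.mem_ofPred_eq]
    refine ⟨?_, fun h => ?_⟩
    · rintro rfl m m'
      simp [mul_comm]
    · obtain ⟨m, hm⟩ := MvPolynomial.ne_zero_iff.mp D.eqn_ne_zero
      have hCD : C.eqn = (C.eqn.coeff m / D.eqn.coeff m) • D.eqn := by
        ext m'
        have := h m m'
        simp only [LinearMap.sub_apply, LinearMap.smul_apply, smul_eq_mul,
          MvPolynomial.lcoeff_apply] at this
        rw [MvPolynomial.coeff_smul, smul_eq_mul]
        field_simp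
        linear_combination this
      have hD : Projectivization.rep D ≠ 0 := Projectivization.rep_nonzero D
      rw [eq_ofForm hD hCD, ofForm, Projectivization.mk_rep D]
  rw [this]
  exact isClosed_iInter fun m => isClosed_iInter fun m' => isClosed_setOf_linear _

/-- A curve moving with coefficients polynomial in a parameter moves continuously, already for the
cofinite topology on the parameters: a polynomial in one variable has finitely many zeros. -/
lemma continuous_ofForm_of_polynomial (v : K → MvPolynomial.homogeneousSubmodule (Fin 3) K d)
    (hv : ∀ x, v x ≠ 0)
    (h : ∀ m, ∃ q : Polynomial K, ∀ x, (v x : MvPolynomial (Fin 3) K).coeff m = q.eval x) :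
    Continuous fun x : CofiniteTopology K =>
      ofForm (v (CofiniteTopology.of.symm x)) (hv _) := by
  refine continuous_generateFrom_iff.mpr ?_
  rintro _ ⟨k, P, hP, rfl⟩
  choose q hq using h
  have key : ∀ x : K, MvPolynomial.eval (fun m => (ofForm (v x) (hv x)).eqn.coeff m) P ≠ 0 ↔
      (MvPolynomial.aeval q P).eval x ≠ 0 := fun x => by
    obtain ⟨a, ha, he⟩ := exists_eqn_ofForm (v x) (hv x)
    have h1 : (fun m => (ofForm (v x) (hv x)).eqn.coeff m) =
        a • fun m => (q m).eval x := by
      ext m; simp [he, hq]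
    have h2 : (MvPolynomial.aeval q P).eval x = MvPolynomial.eval (fun m => (q m).eval x) P := by
      rw [← Polynomial.coe_evalRingHom, MvPolynomial.aeval_def, MvPolynomial.hom_eval₂]
      have : (Polynomial.evalRingHom x).comp (algebraMap K (Polynomial K)) = RingHom.id K := by
        ext; simp
      rw [this]
      rfl
    rw [h1, eval_smul_of_isHomogeneous hP, h2]
    simp [ha]
  rw [CofiniteTopology.isOpen_iff]
  rintro ⟨x, hx⟩
  have hR : MvPolynomial.aeval q P ≠ 0 := fun h0 => by
    have := (key _).mp hx
    simp [h0] at this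
  refine (((MvPolynomial.aeval q P).rootSet_finite K).image CofiniteTopology.of).subset ?_
  intro y hy
  refine ⟨CofiniteTopology.of.symm y, ?_, by simp⟩
  rw [Polynomial.mem_rootSet_of_ne hR, Polynomial.coe_aeval_eq_eval]
  exact not_not.mp fun h0 => hy ((key _).mpr h0)

end PlaneCurve

end CurveSpace

/-! ### The parametrization of the plane by pairs of tangents of a conic -/

section Conic

variable {K : Type*} [Field K]

/-- The linear form in three variables with given coefficients. -/
noncomputable def linForm (a : Fin 3 → K) : MvPolynomial (Fin 3) K :=
  ∑ j, MvPolynomial.C (a j) * MvPolynomial.X j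

lemma eval_linForm (a x : Fin 3 → K) : MvPolynomial.eval x (linForm a) = ∑ j, a j * x j := by
  simp [linForm]

lemma pderiv_linForm (a : Fin 3 → K) (j : Fin 3) :
    MvPolynomial.pderiv j (linForm a) = MvPolynomial.C (a j) := by
  simp [linForm, MvPolynomial.pderiv_X, Pi.single_apply]

lemma exists_eval_eq_weighted_sum_sq (h2 : (2 : K) ≠ 0) {Q : MvPolynomial (Fin 3) K}
    (hQ : Q.IsHomogeneous 2) :
    ∃ (w : Fin 3 → K) (e : (Fin 3 → K) ≃ₗ[K] (Fin 3 → K)),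
      ∀ x, MvPolynomial.eval x Q = ∑ i, w i * e x i ^ 2 := by
  have : Invertible (2 : K) := invertibleOfNonzero h2
  -- the matrix of second derivatives
  have hC : ∀ i j, MvPolynomial.pderiv j (MvPolynomial.pderiv i Q) =
      MvPolynomial.C (MvPolynomial.coeff 0 (MvPolynomial.pderiv j (MvPolynomial.pderiv i Q))) :=
    fun i j => MvPolynomial.totalDegree_eq_zero_iff_eq_C.mp
      (Nat.le_zero.mp (hQ.pderiv.pderiv (i := j)).totalDegree_le)
  have hQ' : ∀ x, 2 * MvPolynomial.eval x Q = ∑ i, x i * ∑ j, x j *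
      MvPolynomial.coeff 0 (MvPolynomial.pderiv j (MvPolynomial.pderiv i Q)) := fun x => by
    have h := congrArg (MvPolynomial.eval x) hQ.sum_X_mul_pderiv
    have h' := fun i => congrArg (MvPolynomial.eval x) (hQ.pderiv (i := i)).sum_X_mul_pderiv
    simp only [map_sum, map_mul, MvPolynomial.eval_X, nsmul_eq_mul, Nat.cast_ofNat, map_ofNat,
      Nat.reduceSub, Nat.cast_one, one_mul] at h h'
    rw [← h]
    refine Finset.sum_congr rfl fun i _ => ?_
    rw [← h' i]
    congr 1
    refine Finset.sum_congr rfl fun j _ => ?_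
    rw [hC i j]; simp
  let M : Matrix (Fin 3) (Fin 3) K := fun i j =>
    ⅟2 * MvPolynomial.coeff 0 (MvPolynomial.pderiv j (MvPolynomial.pderiv i Q))
  let q : QuadraticForm K (Fin 3 → K) := M.toQuadraticForm'
  have hq : ∀ x, q x = MvPolynomial.eval x Q := fun x => by
    have : q x = ⅟2 * (2 * MvPolynomial.eval x Q) := by
      rw [hQ']
      change Matrix.toLinearMap₂' K M x x = _
      rw [Matrix.toLinearMap₂'_apply, Finset.mul_sum]
      refine Finset.sum_congr rfl fun i _ => ?_
      rw [Finset.mul_sum, Finset.mul_sum]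
      refine Finset.sum_congr rfl fun j _ => ?_
      simp only [M, smul_eq_mul]
      ring
    rw [this, ← mul_assoc, invOf_mul_self, one_mul]
  obtain ⟨w, ⟨e⟩⟩ := QuadraticForm.equivalent_weightedSumSquares q
  have key : ∀ m : ℕ, m = 3 → ∀ (w : Fin m → K), 
      q.IsometryEquiv (QuadraticMap.weightedSumSquares K w) →
      ∃ (w : Fin 3 → K) (e : (Fin 3 → K) ≃ₗ[K] (Fin 3 → K)),
      ∀ x, MvPolynomial.eval x Q = ∑ i, w i * e x i ^ 2 := by
    rintro m rfl w e
    refine ⟨w, e.toLinearEquiv, fun x => ?_⟩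
    rw [← hq, ← e.map_app, QuadraticMap.weightedSumSquares_apply]
    simp [sq]
  exact key _ (by simp) w e

lemma not_irreducible_of_two_squares [IsAlgClosed K] (a b : Fin 3 → K) (c d : K) :
    ¬ Irreducible (MvPolynomial.C c * linForm a ^ 2 + MvPolynomial.C d * linForm b ^ 2) := by
  intro h
  obtain ⟨γ, hγ⟩ := IsAlgClosed.exists_eq_mul_self c
  obtain ⟨δ, hδ⟩ := IsAlgClosed.exists_eq_mul_self (-d)
  have hnu : ∀ ε : K, ¬ IsUnit (MvPolynomial.C γ * linForm a + MvPolynomial.C ε * linForm b) :=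
    fun ε hu => by
      have := hu.map (MvPolynomial.eval (0 : Fin 3 → K))
      rw [map_add, map_mul, map_mul, eval_linForm, eval_linForm] at this
      simp at this
  refine (h.isUnit_or_isUnit (a := MvPolynomial.C γ * linForm a + MvPolynomial.C δ * linForm b)
    (b := MvPolynomial.C γ * linForm a + MvPolynomial.C (-δ) * linForm b) ?_).elim
    (hnu _) (hnu _)
  rw [hγ, show d = -(δ * δ) by rw [← hδ]; ring]
  simp only [map_neg, map_mul]
  ring

lemma sum_apply_single_mul (f : (Fin 3 → K) →ₗ[K] (Fin 3 → K)) (x : Fin 3 → K) (i : Fin 3) :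
    ∑ j, f (Pi.single j 1) i * x j = f x i := by
  conv_rhs => rw [← Finset.univ_sum_single x, map_sum, Finset.sum_apply]
  refine Finset.sum_congr rfl fun j _ => ?_
  rw [show Pi.single j (x j) = x j • (Pi.single j 1 : Fin 3 → K) by
    rw [← Pi.single_smul]; simp, map_smul]
  simp [mul_comm]

/-- An irreducible conic is a sum of three squares of independent linear forms. -/
lemma exists_eqn_eq_sum_sq [IsAlgClosed K] (h2 : (2 : K) ≠ 0) {Q : MvPolynomial (Fin 3) K}
    (hQ : Q.IsHomogeneous 2) (hirr : Irreducible Q) :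
    ∃ e : (Fin 3 → K) ≃ₗ[K] (Fin 3 → K),
      Q = ∑ i, linForm (fun j => e (Pi.single j 1) i) ^ 2 := by
  obtain ⟨w, e, he⟩ := exists_eval_eq_weighted_sum_sq h2 hQ
  have hlin := fun f : (Fin 3 → K) ≃ₗ[K] (Fin 3 → K) => sum_apply_single_mul f.toLinearMap
  simp only [LinearEquiv.coe_coe] at hlin
  have hw : ∀ i, w i ≠ 0 := by
    have hQe : Q = ∑ i, MvPolynomial.C (w i) * linForm (fun j => e (Pi.single j 1) i) ^ 2 := by
      refine MvPolynomial.funext fun x => ?_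
      simp [he, eval_linForm, hlin]
    rw [Fin.sum_univ_three] at hQe
    intro i hi
    fin_cases i <;> simp only [Fin.zero_eta, Fin.mk_one, Fin.reduceFinMk] at hi <;>
      simp only [hi, map_zero, zero_mul, add_zero, zero_add] at hQe <;>
      exact not_irreducible_of_two_squares _ _ _ _ (hQe ▸ hirr)
  choose r hr using fun i => IsAlgClosed.exists_eq_mul_self (w i)
  have hr0 : ∀ i, r i ≠ 0 := fun i h => hw i (by rw [hr, h, zero_mul])
  let f := e.trans (LinearEquiv.piCongrRight fun i => LinearEquiv.smulOfNeZero K K (r i) (hr0 i))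
  have hf : ∀ x i, f x i = r i * e x i := fun x i => rfl
  refine ⟨f, MvPolynomial.funext fun x => ?_⟩
  simp only [he, map_sum, map_pow, eval_linForm, hlin]
  refine Finset.sum_congr rfl fun i _ => ?_
  rw [hf, hr]; ring

/-- A parametrization of the points of the plane by pairs of tangents of the conic `Γ`, the tangents
being in turn parametrized by the projective line: `pt s t` is the point of intersection of the
tangents `tan s` and `tan t`, and `pt s s` is the point of contact of `tan s`. All coordinates are
homogeneous. -/
structure TangentParametrization (Γ : PlaneCurve K 2) where
  /-- The intersection of the tangents with parameters `s` and `t`. -/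
  pt : (Fin 2 → K) → (Fin 2 → K) → Fin 3 → K
  /-- The coordinates of the tangent with parameter `s`. -/
  tan : (Fin 2 → K) → Fin 3 → K
  pt_comm : ∀ s t, pt s t = pt t s
  isBinaryForm_pt : ∀ t i, IsBinaryForm 1 (fun s => pt s t i)
  isBinaryForm_pt_self : ∀ i, IsBinaryForm 2 (fun s => pt s s i)
  exists_pt_eq : ∀ x, ∃ s t, pt s t = x
  tan_dot_pt : ∀ s u v, ∑ i, tan s i * pt u v i = bracket s u * bracket s v
  eval_pt : ∀ s t, MvPolynomial.eval (pt s t) Γ.eqn = bracket s t ^ 2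
  eval_pderiv : ∀ s i, MvPolynomial.eval (pt s s) (MvPolynomial.pderiv i Γ.eqn) = -4 * tan s i

/-- A binary quadratic form over an algebraically closed field is a product of linear forms. -/
lemma exists_coeff_eq_mul [IsAlgClosed K] (h2 : (2 : K) ≠ 0) (a b c : K) :
    ∃ s t : Fin 2 → K, s 0 * t 0 = a ∧ s 0 * t 1 + s 1 * t 0 = b ∧ s 1 * t 1 = c := by
  by_cases ha : a = 0
  · exact ⟨![0, 1], ![b, c], by simp [ha]⟩
  · have : NeZero (2 : K) := ⟨h2⟩
    obtain ⟨r, hr⟩ := exists_quadratic_eq_zero (a := a) (b := -b) (c := c) ha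
      (IsAlgClosed.exists_eq_mul_self _)
    refine ⟨![a, b - a * r], ![1, r], by simp, by simp, ?_⟩
    simp only [Matrix.cons_val_one, Matrix.cons_val_fin_one]
    linear_combination -hr

lemma exists_tangentParametrization [IsAlgClosed K] (h2 : (2 : K) ≠ 0) (Γ : PlaneCurve K 2)
    (hΓ : Irreducible Γ.eqn) : Nonempty (TangentParametrization Γ) := by
  obtain ⟨e, he⟩ := exists_eqn_eq_sum_sq h2 Γ.eqn_isHomogeneous hΓ
  obtain ⟨ι, hι⟩ := IsAlgClosed.exists_eq_mul_self (-1 : K)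
  have hlin : ∀ (x : Fin 3 → K) (i : Fin 3), ∑ j, e (Pi.single j 1) i * x j = e x i :=
    sum_apply_single_mul e.toLinearMap
  -- in the coordinates `(ι (a + c), b, a - c)`, a sum of three squares is `b² - 4ac`
  obtain ⟨y, hy⟩ : ∃ y : (Fin 2 → K) → (Fin 2 → K) → Fin 3 → K, ∀ s t, y s t =
      ![ι * (s 0 * t 0 + s 1 * t 1), s 0 * t 1 + s 1 * t 0, s 0 * t 0 - s 1 * t 1] :=
    ⟨_, fun _ _ => rfl⟩
  have hlin' : ∀ (x : Fin 3 → K) (i : Fin 3), e.symm x i =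
      e.symm (Pi.single 0 1) i * x 0 + e.symm (Pi.single 1 1) i * x 1 +
        e.symm (Pi.single 2 1) i * x 2 := fun x i => by
    rw [← Fin.sum_univ_three (fun j => e.symm (Pi.single j 1) i * x j)]
    exact (sum_apply_single_mul e.symm.toLinearMap x i).symm
  have hey : ∀ s t, e (e.symm (y s t)) = y s t := fun s t => e.apply_symm_apply _
  have hgrad : ∀ x i, MvPolynomial.eval x (MvPolynomial.pderiv i Γ.eqn) =
      2 * ∑ k, e x k * e (Pi.single i 1) k := fun x i => by
    rw [he, map_sum, map_sum, Finset.mul_sum]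
    refine Finset.sum_congr rfl fun k _ => ?_
    rw [MvPolynomial.pderiv_pow, pderiv_linForm]
    simp [eval_linForm, hlin]
    ring
  refine ⟨⟨fun s t => e.symm (y s t),
    fun s i => -2⁻¹ * ∑ k, y s s k * e (Pi.single i 1) k, ?_, ?_, ?_, ?_, ?_, ?_, ?_⟩⟩
  · intro s t
    congr 1
    simp only [hy, mul_comm (s _), add_comm (t 1 * _)]
  · intro t i
    have h := IsBinaryForm.linear (e.symm (Pi.single 0 1) i * ι * t 0 +
      e.symm (Pi.single 1 1) i * t 1 + e.symm (Pi.single 2 1) i * t 0)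
      (e.symm (Pi.single 0 1) i * ι * t 1 +
      e.symm (Pi.single 1 1) i * t 0 - e.symm (Pi.single 2 1) i * t 1)
    convert h using 2
    rw [hlin', hy]
    simp; ring
  · intro i
    have h := ((IsBinaryForm.linear 1 0).mul (IsBinaryForm.linear (e.symm (Pi.single 0 1) i * ι +
        e.symm (Pi.single 2 1) i) (2 * e.symm (Pi.single 1 1) i))).add
      ((IsBinaryForm.linear 0 1).mul (IsBinaryForm.linear 0 (e.symm (Pi.single 0 1) i * ι -
        e.symm (Pi.single 2 1) i)))
    convert h using 2
    rw [hlin', hy]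
    simp; ring
  · intro x
    obtain ⟨s, t, ha, hb, hc⟩ := exists_coeff_eq_mul h2 ((-ι * e x 0 + e x 2) / 2) (e x 1)
      ((-ι * e x 0 - e x 2) / 2)
    refine ⟨s, t, ?_⟩
    rw [LinearEquiv.symm_apply_eq]
    ext i
    fin_cases i
    · simp only [hy, ha, hc]
      simp
      field_simp
      linear_combination e x 0 * 2 * hι
    · simp [hy, hb]
    · simp [hy, ha, hc]
      field_simp
      ring
  · intro s u v
    have : ∑ i, (-2⁻¹ * ∑ k, y s s k * e (Pi.single i 1) k) * e.symm (y u v) i =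
        -2⁻¹ * ∑ k, y s s k * y u v k := by
      have hk : ∀ k, y u v k = ∑ i, e (Pi.single i 1) k * e.symm (y u v) i := fun k => by
        rw [hlin, hey]
      simp_rw [hk, mul_assoc, ← Finset.mul_sum, Finset.sum_mul, Finset.mul_sum]
      rw [Finset.sum_comm]
      simp_rw [mul_assoc]
    rw [this, Fin.sum_univ_three]
    simp [hy, bracket]
    field_simp
    linear_combination ((s 0 * s 0 + s 1 * s 1) * (u 0 * v 0 + u 1 * v 1)) * hι
  · intro s t
    conv_lhs => rw [he]
    simp only [map_sum, map_pow, eval_linForm, hlin, hey]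
    rw [Fin.sum_univ_three]
    simp [hy, bracket]
    linear_combination -((s 0 * t 0 + s 1 * t 1) ^ 2) * hι
  · intro s i
    rw [hgrad, hey]
    field_simp
    ring

end Conic

/-! ### Linear forms in three variables -/

section LineForms

variable {K : Type*} [Field K]

lemma linForm_isHomogeneous (a : Fin 3 → K) : (linForm a).IsHomogeneous 1 := by
  refine MvPolynomial.IsHomogeneous.sum _ _ _ fun j _ => ?_
  simpa using (MvPolynomial.isHomogeneous_C _ _).mul (MvPolynomial.isHomogeneous_X K j)

lemma linForm_smul (c : K) (a : Fin 3 → K) : linForm (c • a) = MvPolynomial.C c * linForm a := by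
  simp [linForm, Finset.mul_sum, mul_assoc]

lemma linForm_injective : Function.Injective (linForm : (Fin 3 → K) → MvPolynomial (Fin 3) K) := by
  intro a b h
  ext j
  simpa [pderiv_linForm] using congrArg (MvPolynomial.pderiv j) h

lemma irreducible_linForm {a : Fin 3 → K} (ha : a ≠ 0) : Irreducible (linForm a) := by
  have h0 : linForm a ≠ 0 := fun h => ha (linForm_injective (by rw [h]; simp [linForm]))
  refine MvPolynomial.irreducible_of_totalDegree_eq_one
    ((linForm_isHomogeneous a).totalDegree h0) fun x hx => ?_
  rw [isUnit_iff_ne_zero]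
  rintro rfl
  exact h0 (by ext m; simpa using hx m)

lemma lineForm_eq_linForm (l : Line K) : lineForm l = linForm l.rep := rfl

lemma prime_lineForm (l : Line K) : Prime (lineForm l) :=
  (irreducible_linForm l.rep_nonzero).prime

lemma eq_of_lineForm_dvd {l l' : Line K} (h : lineForm l ∣ lineForm l') : l = l' := by
  obtain ⟨u, hu⟩ := (irreducible_linForm l.rep_nonzero).associated_of_dvd
    (irreducible_linForm l'.rep_nonzero) h
  obtain ⟨c, hc, hcu⟩ := MvPolynomial.isUnit_iff_eq_C_of_isReduced.mp u.isUnit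
  rw [hcu, mul_comm, ← linForm_smul] at hu
  rw [← l.mk_rep, ← l'.mk_rep, Projectivization.mk_eq_mk_iff']
  refine ⟨c⁻¹, ?_⟩
  rw [← linForm_injective hu, smul_smul, inv_mul_cancel₀ hc.ne_zero, one_smul]

lemma PlaneCurve.mk_mem_points {d : ℕ} (C : PlaneCurve K d) {v : Fin 3 → K} (hv : v ≠ 0) :
    (Projectivization.mk K v hv : Point K) ∈ C.points ↔ MvPolynomial.eval v C.eqn = 0 := by
  obtain ⟨a, ha⟩ := Projectivization.exists_smul_eq_mk_rep K v hv
  change MvPolynomial.eval (Projectivization.rep _) C.eqn = 0 ↔ _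
  rw [← ha, Units.smul_def, eval_smul_of_isHomogeneous C.eqn_isHomogeneous]
  simp

lemma exists_bracket_ne_zero₂ {s t : Fin 2 → K} (hs : s ≠ 0) (ht : t ≠ 0) :
    ∃ u, bracket s u ≠ 0 ∧ bracket t u ≠ 0 := by
  obtain ⟨a, ha⟩ := exists_bracket_ne_zero hs
  obtain ⟨b, hb⟩ := exists_bracket_ne_zero ht
  by_cases hta : bracket t a = 0
  · by_cases hsb : bracket s b = 0
    · have hadd : ∀ r : Fin 2 → K, bracket r (a + b) = bracket r a + bracket r b := fun r => by
        simp [bracket]; ring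
      exact ⟨a + b, by simpa [hadd, hsb] using ha, by simpa [hadd, hta] using hb⟩
    · exact ⟨b, hsb, hb⟩
  · exact ⟨a, ha, hta⟩

end LineForms

/-! ### Tangents and their points of intersection -/

namespace TangentParametrization

variable {K : Type*} [Field K] {Γ : PlaneCurve K 2} (τ : TangentParametrization Γ)

lemma pt_smul_left (c : K) (s t : Fin 2 → K) : τ.pt (c • s) t = c • τ.pt s t := by
  ext i
  simpa using (τ.isBinaryForm_pt t i).map_smul c s

lemma pt_smul_right (c : K) (s t : Fin 2 → K) : τ.pt s (c • t) = c • τ.pt s t := by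
  rw [τ.pt_comm, pt_smul_left, τ.pt_comm]

lemma pt_ne_zero {s t : Fin 2 → K} (hs : s ≠ 0) (ht : t ≠ 0) : τ.pt s t ≠ 0 := fun h => by
  obtain ⟨u, hu, hu'⟩ := exists_bracket_ne_zero₂ hs ht
  have := τ.tan_dot_pt u s t
  rw [bracket_swap u s, bracket_swap u t] at this
  simp [h, hu, hu'] at this

lemma tan_ne_zero {s : Fin 2 → K} (hs : s ≠ 0) : τ.tan s ≠ 0 := fun h => by
  obtain ⟨u, hu⟩ := exists_bracket_ne_zero hs
  have := τ.tan_dot_pt s u u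
  simp [h, hu] at this

lemma tan_smul (c : K) (s : Fin 2 → K) : τ.tan (c • s) = c ^ 2 • τ.tan s := by
  ext i
  obtain ⟨u, v, h⟩ := τ.exists_pt_eq (Pi.single i 1)
  have h₁ := τ.tan_dot_pt (c • s) u v
  have h₂ := τ.tan_dot_pt s u v
  rw [h, bracket_smul_left, bracket_smul_left] at h₁
  rw [h] at h₂
  simp only [Pi.single_apply, mul_ite, mul_one, mul_zero, Finset.sum_ite_eq', Finset.mem_univ,
    if_true] at h₁ h₂
  rw [Pi.smul_apply, smul_eq_mul, h₁, h₂]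
  ring

/-- The point of intersection of two tangents, as a point of the projective plane. -/
def point {s t : Fin 2 → K} (hs : s ≠ 0) (ht : t ≠ 0) : Point K :=
  Projectivization.mk K (τ.pt s t) (τ.pt_ne_zero hs ht)

/-- The tangent with a given parameter, as a line of the projective plane. -/
def tanLine {s : Fin 2 → K} (hs : s ≠ 0) : Line K :=
  Projectivization.mk K (τ.tan s) (τ.tan_ne_zero hs)

lemma exists_eq_point (p : Point K) :
    ∃ (s t : Fin 2 → K) (hs : s ≠ 0) (ht : t ≠ 0), p = τ.point hs ht := by
  obtain ⟨s, t, h⟩ := τ.exists_pt_eq p.rep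
  have hs : s ≠ 0 := by
    rintro rfl
    apply p.rep_nonzero
    rw [← h]
    simpa using τ.pt_smul_left 0 0 t
  have ht : t ≠ 0 := by
    rintro rfl
    apply p.rep_nonzero
    rw [← h]
    simpa using τ.pt_smul_right 0 s 0
  refine ⟨s, t, hs, ht, ?_⟩
  simp only [point, h, p.mk_rep]

lemma point_comm {s t : Fin 2 → K} (hs : s ≠ 0) (ht : t ≠ 0) : τ.point hs ht = τ.point ht hs := by
  simp only [point, τ.pt_comm s t]

lemma point_eq_of_bracket {s t s' t' : Fin 2 → K} (hs : s ≠ 0) (ht : t ≠ 0) (hs' : s' ≠ 0)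
    (ht' : t' ≠ 0) (h : bracket s' s = 0) (h' : bracket t' t = 0) :
    τ.point hs ht = τ.point hs' ht' := by
  obtain ⟨a, rfl⟩ := exists_smul_of_bracket_eq_zero hs' h
  obtain ⟨b, rfl⟩ := exists_smul_of_bracket_eq_zero ht' h'
  refine (Projectivization.mk_eq_mk_iff' K _ _ _ _).mpr ⟨a * b, ?_⟩
  rw [pt_smul_left, pt_smul_right, smul_smul]

lemma tanLine_eq_iff {s t : Fin 2 → K} (hs : s ≠ 0) (ht : t ≠ 0) :
    τ.tanLine hs = τ.tanLine ht ↔ bracket s t = 0 := by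
  refine ⟨fun h => ?_, fun h => ?_⟩
  · obtain ⟨a, ha⟩ := (Projectivization.mk_eq_mk_iff' K _ _ _ _).mp h
    obtain ⟨u, hu⟩ := exists_bracket_ne_zero hs
    have := τ.tan_dot_pt s t u
    rw [← ha] at this
    simp only [Pi.smul_apply, smul_eq_mul, mul_assoc, ← Finset.mul_sum, τ.tan_dot_pt,
      bracket_self, zero_mul, mul_zero] at this
    simpa [hu] using this.symm
  · obtain ⟨c, rfl⟩ := exists_smul_of_bracket_eq_zero hs h
    have hc : c ≠ 0 := by rintro rfl; simp at ht
    refine (Projectivization.mk_eq_mk_iff' K _ _ _ _).mpr ⟨(c ^ 2)⁻¹, ?_⟩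
    rw [tan_smul, smul_smul, inv_mul_cancel₀ (pow_ne_zero 2 hc), one_smul]

lemma onLine_iff {s u v : Fin 2 → K} (hs : s ≠ 0) (hu : u ≠ 0) (hv : v ≠ 0) :
    OnLine (τ.point hu hv) (τ.tanLine hs) ↔ bracket s u = 0 ∨ bracket s v = 0 := by
  rw [← mul_eq_zero, ← τ.tan_dot_pt]
  unfold OnLine point tanLine
  rw [Projectivization.orthogonal_mk, dotProduct_comm]
  rfl

/-- Two distinct tangents `tan s` and `tan t` meet in the point `pt s t` only. -/
lemma eq_point_of_onLine {s t : Fin 2 → K} (hs : s ≠ 0) (ht : t ≠ 0) (h : bracket s t ≠ 0)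
    {p : Point K} (hps : OnLine p (τ.tanLine hs)) (hpt : OnLine p (τ.tanLine ht)) :
    p = τ.point hs ht := by
  obtain ⟨u, v, hu, hv, rfl⟩ := τ.exists_eq_point p
  have hne : ∀ {w : Fin 2 → K}, w ≠ 0 → bracket s w = 0 → bracket t w ≠ 0 := fun hw h₁ h₂ =>
    h (bracket_eq_zero_trans hw (by rw [bracket_swap, h₁, neg_zero])
      (by rw [bracket_swap, h₂, neg_zero]))
  rcases (τ.onLine_iff hs hu hv).mp hps with h₁ | h₁ <;>
    rcases (τ.onLine_iff ht hu hv).mp hpt with h₂ | h₂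
  · exact absurd h₂ (hne hu h₁)
  · exact τ.point_eq_of_bracket hu hv hs ht h₁ h₂
  · rw [point_comm]; exact τ.point_eq_of_bracket hv hu hs ht h₁ h₂
  · exact absurd h₂ (hne hv h₁)

lemma point_mem_points {d : ℕ} (C : PlaneCurve K d) {s t : Fin 2 → K} (hs : s ≠ 0) (ht : t ≠ 0) :
    τ.point hs ht ∈ C.points ↔ MvPolynomial.eval (τ.pt s t) C.eqn = 0 :=
  C.mk_mem_points _

lemma isTangentAt_tanLine (h2 : (2 : K) ≠ 0) {s : Fin 2 → K} (hs : s ≠ 0) :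
    IsTangentAt (τ.tanLine hs) Γ (τ.point hs hs) := by
  refine ⟨(τ.point_mem_points Γ hs hs).mpr (by rw [τ.eval_pt, bracket_self]; ring), ?_⟩
  obtain ⟨a, ha⟩ := Projectivization.exists_smul_eq_mk_rep K _ (τ.pt_ne_zero hs hs)
  obtain ⟨b, hb⟩ := Projectivization.exists_smul_eq_mk_rep K _ (τ.tan_ne_zero hs)
  have h4 : (4 : K) ≠ 0 := by
    rw [show (4 : K) = 2 * 2 by norm_num]; exact mul_ne_zero h2 h2
  refine ⟨-4 * a * (b : K)⁻¹, by simp [h4], fun i => ?_⟩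
  unfold point tanLine
  rw [← ha, ← hb, Units.smul_def, eval_smul_of_isHomogeneous Γ.eqn_isHomogeneous.pderiv,
    τ.eval_pderiv]
  have hb0 := b.ne_zero
  simp only [Pi.smul_apply, Units.smul_def, smul_eq_mul]
  field_simp
  ring

lemma exists_eq_tanLine_of_isTangent {l : Line K} (h : IsTangent l Γ) :
    ∃ (s : Fin 2 → K) (hs : s ≠ 0), l = τ.tanLine hs := by
  obtain ⟨p, hp, c, hc, hl⟩ := h
  obtain ⟨s, t, hst⟩ := τ.exists_pt_eq p.rep
  have hp' : MvPolynomial.eval p.rep Γ.eqn = 0 := hp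
  have hs : s ≠ 0 := by
    rintro rfl
    apply p.rep_nonzero
    rw [← hst]
    simpa using τ.pt_smul_left 0 0 t
  rw [← hst, τ.eval_pt] at hp'
  obtain ⟨a, rfl⟩ := exists_smul_of_bracket_eq_zero hs (pow_eq_zero_iff two_ne_zero |>.mp hp')
  refine ⟨s, hs, ?_⟩
  rw [← l.mk_rep]
  refine (Projectivization.mk_eq_mk_iff' K _ _ _ _).mpr ⟨c⁻¹ * (a * -4), ?_⟩
  ext i
  have := hl i
  rw [← hst, pt_smul_right, eval_smul_of_isHomogeneous Γ.eqn_isHomogeneous.pderiv,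
    τ.eval_pderiv] at this
  simp only [Pi.smul_apply, smul_eq_mul]
  rw [mul_assoc, inv_mul_eq_iff_eq_mul₀ hc, ← this]
  simp
  ring

lemma exists_eval_lineForm {s : Fin 2 → K} (hs : s ≠ 0) : ∃ c : K, c ≠ 0 ∧ ∀ u v,
    MvPolynomial.eval (τ.pt u v) (lineForm (τ.tanLine hs)) = c * (bracket s u * bracket s v) := by
  obtain ⟨b, hb⟩ := Projectivization.exists_smul_eq_mk_rep K _ (τ.tan_ne_zero hs)
  refine ⟨b, b.ne_zero, fun u v => ?_⟩
  rw [lineForm_eq_linForm, tanLine, ← hb, Units.smul_def, linForm_smul, map_mul, eval_linForm,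
    τ.tan_dot_pt, MvPolynomial.eval_C]

lemma eq_of_eval_pt [Infinite K] {P Q : MvPolynomial (Fin 3) K}
    (h : ∀ u v, MvPolynomial.eval (τ.pt u v) P = MvPolynomial.eval (τ.pt u v) Q) : P = Q :=
  MvPolynomial.funext fun x => by
    obtain ⟨u, v, rfl⟩ := τ.exists_pt_eq x
    exact h u v

lemma isBinaryForm_eval_pt {d : ℕ} {Q : MvPolynomial (Fin 3) K} (hQ : Q.IsHomogeneous d)
    (v : Fin 2 → K) : IsBinaryForm d fun u => MvPolynomial.eval (τ.pt u v) Q := by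
  simpa using IsBinaryForm.comp_forms hQ (τ.isBinaryForm_pt v)

lemma isBinaryForm_eval_pt_self {d : ℕ} {Q : MvPolynomial (Fin 3) K} (hQ : Q.IsHomogeneous d) :
    IsBinaryForm (2 * d) fun u => MvPolynomial.eval (τ.pt u u) Q :=
  IsBinaryForm.comp_forms hQ τ.isBinaryForm_pt_self

end TangentParametrization

/-! ### Multiple zeros of binary forms -/

section DoubleZeros

variable {K : Type*} [Field K]

/-- The form `h` of degree `d + 2` has a multiple zero at the point `s` of the projective line, i.e.
is divisible by the square of `bracket s`. -/
def HasDoubleZero (d : ℕ) (h : (Fin 2 → K) → K) (s : Fin 2 → K) : Prop :=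
  ∃ k, IsBinaryForm d k ∧ ∀ u, h u = bracket s u ^ 2 * k u

lemma HasDoubleZero.of_smul {d : ℕ} {h : (Fin 2 → K) → K} {s : Fin 2 → K} {c : K}
    (H : HasDoubleZero d h (c • s)) : HasDoubleZero d h s := by
  obtain ⟨k, hk, H⟩ := H
  exact ⟨_, hk.const_mul (c ^ 2), fun u => by rw [H, bracket_smul_left]; ring⟩

/-- A binary form that vanishes off one point of the projective line vanishes there too. -/
lemma IsBinaryForm.eq_zero_of_bracket_mul [Infinite K] {d : ℕ} {φ : (Fin 2 → K) → K}
    (hφ : IsBinaryForm d φ) {s : Fin 2 → K} (hs : s ≠ 0) (h : ∀ u, bracket s u * φ u = 0)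
    (u : Fin 2 → K) : φ u = 0 := by
  obtain ⟨P, -, hP⟩ := hφ
  obtain ⟨Q, -, hQ⟩ := bracket_left s
  have hQP : Q * P = 0 := MvPolynomial.funext fun u => by simp [hP, hQ, h]
  rcases mul_eq_zero.mp hQP with h0 | h0
  · obtain ⟨v, hv⟩ := exists_bracket_ne_zero hs
    simp [← hQ, h0] at hv
  · simp [← hP, h0]

lemma not_hasDoubleZero_prod [Infinite K] {d : ℕ} {t : Fin (d + 2) → Fin 2 → K}
    (ht : ∀ i j, i ≠ j → bracket (t i) (t j) ≠ 0) (s : Fin 2 → K) :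
    ¬ HasDoubleZero d (fun u => ∏ i, bracket (t i) u) s := by
  rintro ⟨k, hk, H⟩
  have ht0 : ∀ i, t i ≠ 0 := fun i h => by
    obtain ⟨j, hj⟩ := exists_ne i
    exact ht i j hj.symm (by simp [h, bracket])
  obtain ⟨i, hi⟩ : ∃ i, bracket (t i) s = 0 := by
    have := H s
    simpa [bracket_self, Finset.prod_eq_zero_iff] using this
  obtain ⟨c, hc⟩ := exists_smul_of_bracket_eq_zero (ht0 i) hi
  -- cancelling one factor, the remaining factors would have a zero at `t i`
  have hform : IsBinaryForm (d + 1) fun u =>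
      ∏ j, bracket (t (i.succAbove j)) u - c ^ 2 * (bracket (t i) u * k u) := by
    refine (IsBinaryForm.prod fun j => IsBinaryForm.bracket_left _).sub
      (IsBinaryForm.const_mul _ ?_)
    rw [add_comm]
    exact (IsBinaryForm.bracket_left _).mul hk
  have h0 := hform.eq_zero_of_bracket_mul (ht0 i) (fun u => by
    have := H u
    simp only at this
    rw [Fin.prod_univ_succAbove _ i, hc, bracket_smul_left] at this
    linear_combination this) (t i)
  simp only [bracket_self, zero_mul, mul_zero, sub_zero, Finset.prod_eq_zero_iff] at h0
  obtain ⟨j, -, hj⟩ := h0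
  exact ht _ _ (Fin.succAbove_ne i j) hj

end DoubleZeros

/-! ### Laterals defined by binary forms -/

namespace TangentParametrization

variable {K : Type*} [Field K] [IsAlgClosed K] {Γ : PlaneCurve K 2} (τ : TangentParametrization Γ)

/-- The form `h` on the projective line defines the lateral `M`: the sides of `M` are the tangents
whose parameters are the zeros of `h`, with multiplicities. In the coordinates on the plane given by
pairs of tangents, the equation of `M` is `h ⊗ h` up to a scalar. -/
def IsLateralOf {d : ℕ} (M : PlaneCurve K d) (h : (Fin 2 → K) → K) : Prop :=
  ∃ c : K, c ≠ 0 ∧ ∀ u v, MvPolynomial.eval (τ.pt u v) M.eqn = c * (h u * h v)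

omit [IsAlgClosed K] in
lemma exists_eval_prod_lineForm {m : ℕ} {t : Fin m → Fin 2 → K} (ht : ∀ i, t i ≠ 0) :
    ∃ c : K, c ≠ 0 ∧ ∀ u v, MvPolynomial.eval (τ.pt u v) (∏ i, lineForm (τ.tanLine (ht i))) =
      c * ((∏ i, bracket (t i) u) * ∏ i, bracket (t i) v) := by
  choose c hc h using fun i => τ.exists_eval_lineForm (ht i)
  refine ⟨∏ i, c i, Finset.prod_ne_zero_iff.mpr fun i _ => hc i, fun u v => ?_⟩
  rw [map_prod, ← Finset.prod_mul_distrib, ← Finset.prod_mul_distrib]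
  exact Finset.prod_congr rfl fun i _ => h i u v

omit [IsAlgClosed K] in
lemma isHomogeneous_prod_lineForm {m : ℕ} (l : Fin m → Line K) :
    (∏ i, lineForm (l i)).IsHomogeneous m := by
  have h := MvPolynomial.IsHomogeneous.prod Finset.univ (fun i => lineForm (l i)) (fun _ => 1)
    (fun i _ => linForm_isHomogeneous (l i).rep)
  rwa [Finset.sum_const, Finset.card_univ, Fintype.card_fin, smul_eq_mul, mul_one] at h

/-- For every binary form `h` of degree `d` there is a ternary form of degree `d` that is `h ⊗ h` in
terms of pairs of tangents: a product of equations of tangents, since `h` splits. -/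
lemma exists_eval_pt_eq_mul {d : ℕ} {h : (Fin 2 → K) → K} (hh : IsBinaryForm d h) :
    ∃ A : MvPolynomial (Fin 3) K, A.IsHomogeneous d ∧
      ∀ u v, MvPolynomial.eval (τ.pt u v) A = h u * h v := by
  by_cases h0 : ∃ s, h s ≠ 0
  · obtain ⟨c, hc, t, ht, H⟩ := hh.exists_factorization h0
    obtain ⟨b, hb, hb'⟩ := τ.exists_eval_prod_lineForm ht
    refine ⟨MvPolynomial.C (c ^ 2 * b⁻¹) * ∏ i, lineForm (τ.tanLine (ht i)), ?_, fun u v => ?_⟩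
    · have h := (MvPolynomial.isHomogeneous_C (Fin 3) (c ^ 2 * b⁻¹)).mul
        (isHomogeneous_prod_lineForm fun i => τ.tanLine (ht i))
      rwa [zero_add] at h
    · rw [map_mul, hb', H, H, MvPolynomial.eval_C]
      field_simp
  · push Not at h0
    exact ⟨0, MvPolynomial.isHomogeneous_zero _ _ _, by simp [h0]⟩

namespace IsLateralOf

variable {τ} {d : ℕ} {M : PlaneCurve K d} {h : (Fin 2 → K) → K}

lemma exists_ne_zero (H : τ.IsLateralOf M h) : ∃ s, h s ≠ 0 := by
  by_contra! h0
  obtain ⟨c, hc, H⟩ := H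
  exact M.eqn_ne_zero (τ.eq_of_eval_pt fun u v => by simp [H, h0])

lemma associated {c : K} (hc : c ≠ 0) {t : Fin d → Fin 2 → K} (ht : ∀ i, t i ≠ 0)
    (ht' : ∀ u, h u = c * ∏ i, bracket (t i) u) (H : τ.IsLateralOf M h) :
    Associated M.eqn (∏ i, lineForm (τ.tanLine (ht i))) := by
  obtain ⟨a, ha, H⟩ := H
  obtain ⟨b, hb, hb'⟩ := τ.exists_eval_prod_lineForm ht
  have hu : IsUnit (MvPolynomial.C (b * (a * c ^ 2)⁻¹) : MvPolynomial (Fin 3) K) :=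
    IsUnit.map _ (isUnit_iff_ne_zero.mpr (by simp [ha, hb, hc]))
  refine ⟨hu.unit, τ.eq_of_eval_pt fun u v => ?_⟩
  rw [hb', map_mul, H, IsUnit.unit_spec, MvPolynomial.eval_C, ht', ht']
  field_simp

lemma exists_zero_of_isSide (hh : IsBinaryForm d h) (H : τ.IsLateralOf M h) {l : Line K}
    (hl : IsSide l M) : ∃ (s : Fin 2 → K) (hs : s ≠ 0), h s = 0 ∧ l = τ.tanLine hs := by
  obtain ⟨c, hc, t, ht, ht'⟩ := hh.exists_factorization H.exists_ne_zero
  have hdvd := hl.trans (H.associated hc ht ht').dvd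
  obtain ⟨i, -, hi⟩ := (prime_lineForm l).exists_mem_finset_dvd hdvd
  refine ⟨t i, ht i, ?_, eq_of_lineForm_dvd hi⟩
  rw [ht', Finset.prod_eq_zero (Finset.mem_univ i) (bracket_self _), mul_zero]

lemma isSide (hh : IsBinaryForm d h) (H : τ.IsLateralOf M h) {s : Fin 2 → K} (hs : s ≠ 0)
    (h0 : h s = 0) : IsSide (τ.tanLine hs) M := by
  obtain ⟨c, hc, t, ht, ht'⟩ := hh.exists_factorization H.exists_ne_zero
  obtain ⟨i, hi⟩ : ∃ i, bracket (t i) s = 0 := by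
    simpa [ht', hc, Finset.prod_eq_zero_iff] using h0
  rw [← (τ.tanLine_eq_iff (ht i) hs).mpr hi]
  exact (Finset.dvd_prod_of_mem (fun i => lineForm (τ.tanLine (ht i))) (Finset.mem_univ i)).trans
    (H.associated hc ht ht').symm.dvd

lemma lineForm_sq_dvd {e : ℕ} (H : τ.IsLateralOf M h) {s : Fin 2 → K} (hs : s ≠ 0)
    (h2 : HasDoubleZero e h s) : lineForm (τ.tanLine hs) ^ 2 ∣ M.eqn := by
  obtain ⟨k, hk, hk'⟩ := h2
  obtain ⟨A, -, hA⟩ := τ.exists_eval_pt_eq_mul hk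
  obtain ⟨c, hc, H⟩ := H
  obtain ⟨b, hb, hb'⟩ := τ.exists_eval_lineForm hs
  refine ⟨MvPolynomial.C (c * (b ^ 2)⁻¹) * A, τ.eq_of_eval_pt fun u v => ?_⟩
  rw [H, map_mul, map_mul, map_pow, hA, hb', hk', hk', MvPolynomial.eval_C]
  field_simp

lemma isCircumscribedAbout (h2 : (2 : K) ≠ 0) (hh : IsBinaryForm d h) (H : τ.IsLateralOf M h) :
    IsCircumscribedAbout M Γ := by
  intro l hl
  obtain ⟨s, hs, -, rfl⟩ := H.exists_zero_of_isSide hh hl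
  exact ⟨_, τ.isTangentAt_tanLine h2 hs⟩

lemma mem_vertices (hh : IsBinaryForm d h) (H : τ.IsLateralOf M h) {s t : Fin 2 → K} (hs : s ≠ 0)
    (ht : t ≠ 0) (hst : bracket s t ≠ 0) (h₁ : h s = 0) (h₂ : h t = 0) :
    τ.point hs ht ∈ vertices M :=
  ⟨τ.tanLine hs, τ.tanLine ht, fun h => hst ((τ.tanLine_eq_iff hs ht).mp h), H.isSide hh hs h₁,
    H.isSide hh ht h₂, (τ.onLine_iff hs hs ht).mpr (Or.inl (bracket_self s)),
    (τ.onLine_iff ht hs ht).mpr (Or.inr (bracket_self t))⟩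

lemma exists_of_mem_vertices (hh : IsBinaryForm d h) (H : τ.IsLateralOf M h) {p : Point K}
    (hp : p ∈ vertices M) : ∃ (s t : Fin 2 → K) (hs : s ≠ 0) (ht : t ≠ 0), bracket s t ≠ 0 ∧
      h s = 0 ∧ h t = 0 ∧ p = τ.point hs ht := by
  obtain ⟨l, l', hne, hl, hl', hpl, hpl'⟩ := hp
  obtain ⟨s, hs, hs0, rfl⟩ := H.exists_zero_of_isSide hh hl
  obtain ⟨t, ht, ht0, rfl⟩ := H.exists_zero_of_isSide hh hl'
  have hst : bracket s t ≠ 0 := fun h => hne ((τ.tanLine_eq_iff hs ht).mpr h)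
  exact ⟨s, t, hs, ht, hst, hs0, ht0, τ.eq_point_of_onLine hs ht hst hpl hpl'⟩

lemma finite_vertices (hh : IsBinaryForm d h) (H : τ.IsLateralOf M h) : (vertices M).Finite := by
  obtain ⟨c, hc, t, ht, ht'⟩ := hh.exists_factorization H.exists_ne_zero
  refine (Set.finite_range fun i : Fin d × Fin d => τ.point (ht i.1) (ht i.2)).subset ?_
  intro p hp
  obtain ⟨s, u, hs, hu, -, hs0, hu0, rfl⟩ := H.exists_of_mem_vertices hh hp
  obtain ⟨i, hi⟩ : ∃ i, bracket (t i) s = 0 := by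
    simpa [ht', hc, Finset.prod_eq_zero_iff] using hs0
  obtain ⟨j, hj⟩ : ∃ j, bracket (t j) u = 0 := by
    simpa [ht', hc, Finset.prod_eq_zero_iff] using hu0
  exact ⟨(i, j), (τ.point_eq_of_bracket hs hu (ht i) (ht j) hi hj).symm⟩

lemma isGeneralLateral {e : ℕ} {M : PlaneCurve K (e + 2)} (hh : IsBinaryForm (e + 2) h)
    (H : τ.IsLateralOf M h) (h2 : ∀ s, s ≠ 0 → ¬ HasDoubleZero e h s) : IsGeneralLateral M := by
  obtain ⟨c, hc, t, ht, ht'⟩ := hh.exists_factorization H.exists_ne_zero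
  have hne : ∀ i j, i ≠ j → bracket (t i) (t j) ≠ 0 := fun i j hij h0 => by
    obtain ⟨b, hb⟩ := exists_smul_of_bracket_eq_zero (ht i) h0
    obtain ⟨k, rfl⟩ := Fin.exists_succAbove_eq hij.symm
    refine h2 (t i) (ht i) ⟨_, (IsBinaryForm.prod fun j =>
      IsBinaryForm.bracket_left (t (i.succAbove (k.succAbove j)))).const_mul (c * b), fun u => ?_⟩
    rw [ht', Fin.prod_univ_succAbove _ i, Fin.prod_univ_succAbove _ k, hb, bracket_smul_left]
    ring
  refine ⟨fun i => τ.tanLine (ht i), H.associated hc ht ht', fun i j hij => ?_, ?_⟩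
  · by_contra h
    exact hne i j h ((τ.tanLine_eq_iff (ht i) (ht j)).mp hij)
  · rintro i j k hij hik hjk p ⟨hi, hj, hk⟩
    rw [τ.eq_point_of_onLine (ht i) (ht j) (hne i j hij) hi hj, τ.onLine_iff] at hk
    exact hk.elim (hne k i hik.symm) (hne k j hjk.symm)

end IsLateralOf

omit [IsAlgClosed K] in
/-- A general lateral circumscribed about `Γ` comes from a form with distinct zeros. -/
lemma exists_isLateralOf {m : ℕ} {L : PlaneCurve K m} (hL : IsGeneralLateral L)
    (hLΓ : IsCircumscribedAbout L Γ) :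
    ∃ t : Fin m → Fin 2 → K, (∀ i, t i ≠ 0) ∧ (∀ i j, i ≠ j → bracket (t i) (t j) ≠ 0) ∧
      τ.IsLateralOf L fun u => ∏ i, bracket (t i) u := by
  obtain ⟨l, hl, hinj, -⟩ := hL
  have hside : ∀ i, IsSide (l i) L := fun i =>
    (Finset.dvd_prod_of_mem (fun i => lineForm (l i)) (Finset.mem_univ i)).trans hl.symm.dvd
  choose t ht hlt using fun i => τ.exists_eq_tanLine_of_isTangent (hLΓ _ (hside i))
  refine ⟨t, ht, fun i j hij h => hij (hinj ?_), ?_⟩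
  · rw [hlt i, hlt j, τ.tanLine_eq_iff, h]
  · obtain ⟨u, hu⟩ := hl.symm
    obtain ⟨a, ha, hau⟩ := MvPolynomial.isUnit_iff_eq_C_of_isReduced.mp u.isUnit
    obtain ⟨b, hb, hb'⟩ := τ.exists_eval_prod_lineForm ht
    refine ⟨a * b, mul_ne_zero ha.ne_zero hb, fun v w => ?_⟩
    simp only [hlt] at hu
    rw [← hu, map_mul, hb', hau, MvPolynomial.eval_C]
    ring

end TangentParametrization

/-! ### Bezoutians -/

section Bezoutian

variable {K : Type*} [Field K] [IsAlgClosed K]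

/-- A symmetric form `G` of bidegree `(d, d)` that vanishes at all pairs of distinct zeros of a form
`f` of degree `d + 1` with `d + 1` distinct zeros is the Bezoutian of `f` and another form `g`. -/
lemma exists_bezoutian {d : ℕ} {G : (Fin 2 → K) → (Fin 2 → K) → K} (hsymm : ∀ u v, G u v = G v u)
    (hG : ∀ v, IsBinaryForm d fun u => G u v) {t : Fin (d + 1) → Fin 2 → K}
    (hti0 : ∀ i, t i ≠ 0)
    (ht : ∀ i j, i ≠ j → bracket (t i) (t j) ≠ 0) (hGt : ∀ i j, i ≠ j → G (t i) (t j) = 0)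
    {f : (Fin 2 → K) → K} (hf : IsBinaryForm (d + 1) f) (hft : ∀ i, f (t i) = 0)
    {a : Fin 2 → K} (ha : f a ≠ 0) :
    ∃ g, IsBinaryForm (d + 1) g ∧ ∀ u v, bracket u v * G u v = f u * g v - f v * g u := by
  have hat : ∀ i, bracket (t i) a ≠ 0 := fun i h => ha (by
    have hti : t i ≠ 0 := hti0 i
    obtain ⟨c, rfl⟩ := exists_smul_of_bracket_eq_zero hti h
    rw [hf.map_smul, hft, mul_zero])
  -- a form of degree `d + 1` vanishing at all `t i` and at `a` is zero
  have key : ∀ {φ : (Fin 2 → K) → K}, IsBinaryForm (d + 1) φ → (∀ i, φ (t i) = 0) → φ a = 0 →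
      ∀ u, φ u = 0 := fun {φ} hφ h₁ h₂ => by
    refine hφ.eq_zero_of_zeros (ι := Option (Fin (d + 1))) (by simp) (fun o => o.elim a t) ?_ ?_
    · rintro (_ | i) (_ | j) hij
      · exact absurd rfl hij
      · rw [bracket_swap]; exact neg_ne_zero.mpr (hat j)
      · exact hat i
      · exact ht i j fun h => hij (congrArg some h)
    · rintro (_ | i)
      exacts [h₂, h₁ i]
  have hH : ∀ v, IsBinaryForm (d + 1) fun u => bracket v u * G v u := fun v => by
    have h := (IsBinaryForm.bracket_left v).mul (hG v)
    rw [add_comm] at h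
    simpa only [hsymm v] using h
  have hanti : ∀ u v, bracket u v * G u v = - (bracket v u * G v u) := fun u v => by
    rw [bracket_swap, hsymm]; ring
  have h₁ : ∀ i u, f a * (bracket (t i) u * G (t i) u) - bracket (t i) a * G (t i) a * f u = 0 :=
    fun i => key (((hH (t i)).const_mul _).sub (hf.const_mul _)) (fun j => by
      rcases eq_or_ne i j with rfl | hij
      · simp [bracket_self, hft]
      · simp [hGt i j hij, hft]) (by ring)
  have h₂ : ∀ u v, f a * (bracket u v * G u v) - f u * (bracket a v * G a v) +
      bracket a u * G a u * f v = 0 := fun u =>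
    key ((((hH u).const_mul _).sub ((hH a).const_mul _)).add (hf.const_mul _)) (fun i => by
      rw [hanti u, hanti a (t i), hft]
      linear_combination - h₁ i u) (by rw [hanti u a, bracket_self]; ring)
  -- `g` is determined up to adding multiples of `f`; this is the choice with `g a = 0`
  refine ⟨_, (hH a).const_mul (f a)⁻¹, fun u v => ?_⟩
  field_simp
  linear_combination h₂ u v

/-- A form of bidegree `(d, d)` that vanishes on a grid of `(d + 1)²` points is zero. -/
lemma eq_zero_of_grid {d : ℕ} {G : (Fin 2 → K) → (Fin 2 → K) → K} (hsymm : ∀ u v, G u v = G v u)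
    (hG : ∀ v, IsBinaryForm d fun u => G u v) {t : Fin (d + 1) → Fin 2 → K}
    (ht : ∀ i j, i ≠ j → bracket (t i) (t j) ≠ 0) (hGt : ∀ i j, G (t i) (t j) = 0)
    (u v : Fin 2 → K) : G u v = 0 := by
  have h₁ : ∀ i v, G v (t i) = 0 := fun i =>
    (hG (t i)).eq_zero_of_zeros (by simp) t ht fun j => hGt j i
  exact (hG v).eq_zero_of_zeros (by simp) t ht (fun i => by rw [hsymm]; exact h₁ i v) u

end Bezoutian

/-! ### Pencils of laterals -/

namespace TangentParametrization

variable {K : Type*} [Field K] [IsAlgClosed K] {Γ : PlaneCurve K 2} (τ : TangentParametrization Γ)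

/-- The laterals of the members `f + x g` and `g` of the pencil spanned by two independent binary
forms. Leaving out finitely many of them gives a one-dimensional family, whose closure contains the
laterals of all members. -/
lemma exists_pencil {d : ℕ} {f g : (Fin 2 → K) → K} (hf : IsBinaryForm d f) (hg : IsBinaryForm d g)
    (hfg : ∀ a b : K, (∀ u, a * f u + b * g u = 0) → a = 0 ∧ b = 0) :
    ∃ (γ : K → PlaneCurve K d) (δ : PlaneCurve K d),
      (∀ x, τ.IsLateralOf (γ x) fun u => f u + x * g u) ∧ τ.IsLateralOf δ g ∧
      ∀ B : Set K, B.Finite → IsOneDimFamily (γ '' Bᶜ) ∧ (∀ x, γ x ∈ closure (γ '' Bᶜ)) ∧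
        δ ∈ closure (γ '' Bᶜ) := by
  obtain ⟨A, hA, hA'⟩ := τ.exists_eval_pt_eq_mul hf
  obtain ⟨D, hD, hD'⟩ := τ.exists_eval_pt_eq_mul hg
  -- polarizing the equation of `f + g` gives the mixed term `f ⊗ g + g ⊗ f`
  obtain ⟨S, hS, hS'⟩ := τ.exists_eval_pt_eq_mul (hf.add hg)
  let Φ : (Fin 3 → K) →ₗ[K] MvPolynomial (Fin 3) K :=
    Fintype.linearCombination K ![A, S - A - D, D]
  have hΦ : ∀ x, Φ x = x 0 • A + x 1 • (S - A - D) + x 2 • D := fun x => by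
    simp [Φ, Fintype.linearCombination_apply, Fin.sum_univ_three]
  have hΦe : ∀ x u v, MvPolynomial.eval (τ.pt u v) (Φ x) =
      x 0 * (f u * f v) + x 1 * (f u * g v + g u * f v) + x 2 * (g u * g v) := fun x u v => by
    simp only [hΦ, map_add, map_sub, MvPolynomial.smul_eval, hA', hD', hS']
    ring
  have hΦh : ∀ x, (Φ x).IsHomogeneous d := fun x => by
    have hsm : ∀ (c : K) {P : MvPolynomial (Fin 3) K}, P.IsHomogeneous d →
        (c • P).IsHomogeneous d := fun c P hP =>
      (MvPolynomial.homogeneousSubmodule (Fin 3) K d).smul_mem c hP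
    rw [hΦ]
    exact ((hsm _ hA).add (hsm _ ((hS.sub hA).sub hD))).add (hsm _ hD)
  have hΦ0 : ∀ x, Φ x = 0 → x = 0 := fun x hx => by
    have h : ∀ v, x 0 * f v + x 1 * g v = 0 ∧ x 1 * f v + x 2 * g v = 0 := fun v =>
      hfg _ _ fun u => by
        have := hΦe x u v
        rw [hx, map_zero] at this
        linear_combination -this
    have h₁ := hfg _ _ fun v => (h v).1
    have h₂ := hfg _ _ fun v => (h v).2
    ext i; fin_cases i
    exacts [h₁.1, h₁.2, h₂.2]
  have hΦi : Function.Injective Φ := (injective_iff_map_eq_zero Φ).mpr hΦ0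
  let q : K → K → Fin 3 → K := fun a b => ![a ^ 2, a * b, b ^ 2]
  let w : K → K → MvPolynomial.homogeneousSubmodule (Fin 3) K d := fun a b => ⟨Φ (q a b), hΦh _⟩
  have hw : ∀ a b : K, a ≠ 0 ∨ b ≠ 0 → w a b ≠ 0 := fun a b hab h => by
    have h0 := hΦ0 _ (congrArg Subtype.val h)
    have h₁ := congrFun h0 0
    have h₂ := congrFun h0 2
    simp [q] at h₁ h₂
    tauto
  have hl : ∀ x : K, (1 : K) ≠ 0 ∨ x ≠ 0 := fun _ => Or.inl one_ne_zero
  have hr : ∀ x : K, x ≠ 0 ∨ (1 : K) ≠ 0 := fun _ => Or.inr one_ne_zero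
  -- the coefficients of `w a b` are polynomials in each of the variables
  have hpoly₁ : ∀ m, ∃ p : Polynomial K, ∀ x, (w 1 x : MvPolynomial (Fin 3) K).coeff m = p.eval x :=
    fun m => ⟨Polynomial.C (A.coeff m) + Polynomial.X * Polynomial.C ((S - A - D).coeff m) +
      Polynomial.X ^ 2 * Polynomial.C (D.coeff m), fun x => by simp [w, q, hΦ]; ring⟩
  have hpoly₂ : ∀ m, ∃ p : Polynomial K, ∀ x, (w x 1 : MvPolynomial (Fin 3) K).coeff m = p.eval x :=
    fun m => ⟨Polynomial.C (D.coeff m) + Polynomial.X * Polynomial.C ((S - A - D).coeff m) +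
      Polynomial.X ^ 2 * Polynomial.C (A.coeff m), fun x => by simp [w, q, hΦ]; ring⟩
  let γ : K → PlaneCurve K d := fun x => PlaneCurve.ofForm (w 1 x) (hw 1 x (hl x))
  let δ : K → PlaneCurve K d := fun x => PlaneCurve.ofForm (w x 1) (hw x 1 (hr x))
  have hγc : Continuous fun x : CofiniteTopology K => γ (CofiniteTopology.of.symm x) :=
    PlaneCurve.continuous_ofForm_of_polynomial (fun x => w 1 x)
      (fun x => hw 1 x (hl x)) hpoly₁
  have hδc : Continuous fun x : CofiniteTopology K => δ (CofiniteTopology.of.symm x) :=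
    PlaneCurve.continuous_ofForm_of_polynomial (fun x => w x 1)
      (fun x => hw x 1 (hr x)) hpoly₂
  have hlat : ∀ a b (h : a ≠ 0 ∨ b ≠ 0),
      τ.IsLateralOf (PlaneCurve.ofForm (w a b) (hw a b h)) fun u => a * f u + b * g u :=
    fun a b h => by
      obtain ⟨c, hc, hc'⟩ := PlaneCurve.exists_eqn_ofForm (w a b) (hw a b h)
      refine ⟨c, hc, fun u v => ?_⟩
      rw [hc', MvPolynomial.smul_eval, hΦe]
      change c * (a ^ 2 * (f u * f v) + a * b * (f u * g v + g u * f v) + b ^ 2 * (g u * g v)) = _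
      ring
  have hcol : ∀ a b a' b' (h : a ≠ 0 ∨ b ≠ 0) (h' : a' ≠ 0 ∨ b' ≠ 0),
      PlaneCurve.ofForm (w a b) (hw a b h) = PlaneCurve.ofForm (w a' b') (hw a' b' h') →
      ∃ c : K, c • q a' b' = q a b := fun a b a' b' h h' he => by
    obtain ⟨c, hc⟩ := (Projectivization.mk_eq_mk_iff' K _ _ _ _).mp he
    exact ⟨c, hΦi (by rw [map_smul]; exact congrArg Subtype.val hc)⟩
  have hγi : Function.Injective γ := fun x y hxy => by
    obtain ⟨c, hc⟩ := hcol _ _ _ _ (hl x) (hl y) hxy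
    have h₀ := congrFun hc 0
    have h₁ := congrFun hc 1
    simp [q] at h₀ h₁
    rw [h₀, one_mul] at h₁
    exact h₁.symm
  have hγδ : ∀ x, γ x ≠ δ 0 := fun x hx => by
    obtain ⟨c, hc⟩ := hcol _ _ _ _ (hl x) (hr 0) hx
    simpa [q] using congrFun hc 0
  have hδγ : ∀ x, x ≠ 0 → δ x = γ x⁻¹ := fun x hx => by
    refine (Projectivization.mk_eq_mk_iff' K _ _ _ _).mpr ⟨x ^ 2, Subtype.ext ?_⟩
    change x ^ 2 • Φ (q 1 x⁻¹) = Φ (q x 1)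
    rw [← map_smul]
    congr 1
    ext i; fin_cases i <;> simp [q] <;> field_simp
  -- the whole pencil is the conic `x₀ x₂ = x₁²` in the plane spanned by `A`, `S - A - D`, `D`
  obtain ⟨Ψ, hΨ⟩ := Φ.exists_leftInverse_of_injective (LinearMap.ker_eq_bot.mpr hΦi)
  have hΨΦ : ∀ x, Ψ (Φ x) = x := fun x => LinearMap.congr_fun hΨ x
  let X : Set (PlaneCurve K d) := {C | Φ (Ψ C.eqn) = C.eqn ∧ Ψ C.eqn 0 * Ψ C.eqn 2 = Ψ C.eqn 1 ^ 2}
  have hX : IsClosed X := by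
    have hlin : {C : PlaneCurve K d | Φ (Ψ C.eqn) = C.eqn} = ⋂ m, {C : PlaneCurve K d |
        (MvPolynomial.lcoeff K m ∘ₗ (Φ ∘ₗ Ψ - LinearMap.id)) C.eqn = 0} := by
      ext C
      simp [MvPolynomial.ext_iff, sub_eq_zero]
    have hclosed : IsClosed {C : PlaneCurve K d | Φ (Ψ C.eqn) = C.eqn} := by
      rw [hlin]
      exact isClosed_iInter fun m => PlaneCurve.isClosed_setOf_linear _
    exact hclosed.inter (PlaneCurve.isClosed_setOf_mul_eq_sq (LinearMap.proj 0 ∘ₗ Ψ)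
      (LinearMap.proj 1 ∘ₗ Ψ) (LinearMap.proj 2 ∘ₗ Ψ))
  have hXmem : ∀ a b (h : a ≠ 0 ∨ b ≠ 0), PlaneCurve.ofForm (w a b) (hw a b h) ∈ X :=
    fun a b h => by
      obtain ⟨c, hc, hc'⟩ := PlaneCurve.exists_eqn_ofForm (w a b) (hw a b h)
      have : Ψ (PlaneCurve.ofForm (w a b) (hw a b h)).eqn = c • q a b := by
        rw [hc', map_smul]; exact congrArg _ (hΨΦ _)
      refine ⟨?_, ?_⟩
      · rw [this, hc', map_smul]
      · rw [this]; simp [q]; ring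
  have hXsub : ∀ C ∈ X, (∃ x, C = γ x) ∨ C = δ 0 := by
    rintro C ⟨hC, hq⟩
    by_cases h0 : Ψ C.eqn 0 = 0
    · right
      refine PlaneCurve.eq_ofForm (a := Ψ C.eqn 2) (hw 0 1 (hr 0)) ?_
      change C.eqn = Ψ C.eqn 2 • Φ (q 0 1)
      rw [← map_smul, ← hC, hΨΦ]
      congr 1
      have h1 : Ψ C.eqn 1 = 0 := by simpa [h0] using hq.symm
      ext i; fin_cases i <;> simp [q, h0, h1]
    · refine Or.inl ⟨Ψ C.eqn 1 / Ψ C.eqn 0, PlaneCurve.eq_ofForm (a := Ψ C.eqn 0)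
        (hw 1 _ (hl _)) ?_⟩
      change C.eqn = Ψ C.eqn 0 • Φ (q 1 _)
      rw [← map_smul]
      conv_lhs => rw [← hC]
      congr 1
      ext i; fin_cases i <;> simp [q] <;> field_simp
      linear_combination hq
  refine ⟨γ, δ 0, fun x => by simpa using hlat 1 x (hl x), by simpa using hlat 0 1 (hr 0),
    fun B hB => ?_⟩
  have hB' : (CofiniteTopology.of '' B).Finite := hB.image _
  have himg : γ '' Bᶜ = (fun x : CofiniteTopology K => γ (CofiniteTopology.of.symm x)) ''
      (CofiniteTopology.of '' B)ᶜ := by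
    rw [← Set.image_compl_eq CofiniteTopology.of.bijective, Set.image_image]
    simp
  have hcl : ∀ x, γ x ∈ closure (γ '' Bᶜ) := fun x => by
    rw [himg]
    simpa using mem_closure_image_compl hγc hB' (CofiniteTopology.of x)
  refine ⟨⟨?_, ?_, ?_⟩, hcl, ?_⟩
  · have : γ '' Bᶜ = X ∩ (γ '' B ∪ {δ 0})ᶜ := by
      ext C
      constructor
      · rintro ⟨x, hx, rfl⟩
        refine ⟨hXmem _ _ (hl x), ?_⟩
        rintro (⟨y, hy, hxy⟩ | h)
        · exact hx (hγi hxy ▸ hy)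
        · exact hγδ x h
      · rintro ⟨hC, hC'⟩
        rcases hXsub C hC with ⟨x, rfl⟩ | rfl
        · exact ⟨x, fun hx => hC' (Or.inl ⟨x, hx, rfl⟩), rfl⟩
        · exact absurd (Or.inr rfl) hC'
    rw [this]
    exact hX.isLocallyClosed.inter
      ((hB.image γ).union (Set.finite_singleton _)).isClosed.isOpen_compl.isLocallyClosed
  · rw [himg]; exact isIrreducible_image_compl hγc hB'
  · rw [himg]
    exact topologicalKrullDim_image_compl hγc (hγi.comp CofiniteTopology.of.symm.injective) hB'
  · have hfin : (CofiniteTopology.of '' insert 0 (Inv.inv '' B)).Finite :=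
      ((hB.image _).insert _).image _
    have := mem_closure_image_compl hδc hfin (CofiniteTopology.of 0)
    refine closure_mono ?_ this
    rintro _ ⟨x, hx, rfl⟩
    obtain ⟨x, rfl⟩ := CofiniteTopology.of.surjective x
    have hx0 : x ≠ 0 := fun h => hx ⟨x, Or.inl h, rfl⟩
    simp only [Equiv.symm_apply_apply]
    rw [hδγ x hx0]
    exact ⟨x⁻¹, fun hxB => hx ⟨x, Or.inr ⟨x⁻¹, hxB, inv_inv x⟩, rfl⟩, rfl⟩

end TangentParametrization

/-! ### Multiple zeros in a pencil -/

section Pencil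

variable {K : Type*} [Field K]

lemma exists_common_kernel {a b c d : K} (h : a * d - c * b = 0) :
    ∃ x y : K, (x ≠ 0 ∨ y ≠ 0) ∧ x * a + y * b = 0 ∧ x * c + y * d = 0 := by
  by_cases h₁ : a = 0 ∧ b = 0
  · by_cases h₂ : c = 0 ∧ d = 0
    · exact ⟨1, 0, by simp, by simp [h₁], by simp [h₂]⟩
    · exact ⟨d, -c, by simp only [neg_ne_zero]; tauto, by simp [h₁], by ring⟩
  · exact ⟨b, -a, by simp only [neg_ne_zero]; tauto, by ring, by linear_combination -h⟩

variable [IsAlgClosed K] {e : ℕ} {G : (Fin 2 → K) → (Fin 2 → K) → K} {f g : (Fin 2 → K) → K}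

/-- On the diagonal, the Bezoutian of `f` and `g` vanishes at the multiple zeros of the members of
the pencil spanned by `f` and `g`. -/
lemma bezoutian_self_eq_zero (hG : ∀ v, IsBinaryForm (e + 1) (G v))
    (H : ∀ u v, bracket u v * G u v = f u * g v - f v * g u) {x : K} {s : Fin 2 → K} (hs : s ≠ 0)
    (h : HasDoubleZero e (fun u => f u + x * g u) s) : G s s = 0 := by
  obtain ⟨k, hk, hk'⟩ := h
  have hform : IsBinaryForm (e + 1) fun u => G s u + g s * (bracket s u * k u) := by
    refine (hG s).add (IsBinaryForm.const_mul _ ?_)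
    rw [add_comm]
    exact (IsBinaryForm.bracket_left s).mul hk
  have h0 := hform.eq_zero_of_bracket_mul hs (fun u => by
    have hs0 : f s + x * g s = 0 := by simpa [bracket_self] using hk' s
    linear_combination H s u + hs0 * g u - g s * hk' u) s
  simpa [bracket_self] using h0

/-- Where the Bezoutian of `f` and `g` vanishes on the diagonal, some member of the pencil spanned
by `f` and `g` has a multiple zero. -/
lemma exists_hasDoubleZero (hf : IsBinaryForm (e + 2) f) (hg : IsBinaryForm (e + 2) g)
    (hG : ∀ v, IsBinaryForm (e + 1) (G v))
    (H : ∀ u v, bracket u v * G u v = f u * g v - f v * g u) {s : Fin 2 → K} (hs : s ≠ 0)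
    (h : G s s = 0) :
    ∃ x y : K, (x ≠ 0 ∨ y ≠ 0) ∧ HasDoubleZero e (fun u => x * f u + y * g u) s := by
  by_cases h0 : f s = 0 ∧ g s = 0
  · -- at a base point of the pencil, one linear condition makes the zero a multiple one
    obtain ⟨f', hf', hff'⟩ := hf.exists_eq_bracket_mul hs h0.1
    obtain ⟨g', hg', hgg'⟩ := hg.exists_eq_bracket_mul hs h0.2
    have hxy : ∃ x y : K, (x ≠ 0 ∨ y ≠ 0) ∧ x * f' s + y * g' s = 0 := by
      obtain ⟨x, y, hxy, h, -⟩ := exists_common_kernel (a := f' s) (b := g' s) (c := 0) (d := 0)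
        (by simp)
      exact ⟨x, y, hxy, h⟩
    obtain ⟨x, y, hxy, hz⟩ := hxy
    obtain ⟨k, hk, hk'⟩ := ((hf'.const_mul x).add (hg'.const_mul y)).exists_eq_bracket_mul hs hz
    exact ⟨x, y, hxy, k, hk, fun u => by
      simp only
      rw [hff', hgg']
      linear_combination bracket s u * hk' u⟩
  · obtain ⟨k, hk, hk'⟩ := (hG s).exists_eq_bracket_mul hs h
    refine ⟨-g s, f s, by simp only [neg_ne_zero]; tauto, k, hk, fun u => ?_⟩
    simp only
    linear_combination bracket s u * hk' u - H s u

/-- A pencil with a member without multiple zeros has finitely many members with multiple zeros. -/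
lemma finite_setOf_hasDoubleZero {t : Fin (e + 2) → Fin 2 → K}
    (ht : ∀ i j, i ≠ j → bracket (t i) (t j) ≠ 0) (hft : ∀ u, f u = ∏ i, bracket (t i) u)
    (hG : ∀ v, IsBinaryForm (e + 1) (G v)) {d : ℕ} (hD : IsBinaryForm d fun u => G u u)
    (hD0 : ∃ u, G u u ≠ 0) (H : ∀ u v, bracket u v * G u v = f u * g v - f v * g u) :
    {x : K | ∃ s, s ≠ 0 ∧ HasDoubleZero e (fun u => f u + x * g u) s}.Finite := by
  obtain ⟨c, hc, z, hz, hD'⟩ := hD.exists_factorization hD0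
  refine (Set.finite_iUnion (ι := Fin d)
    (f := fun k => {x : K | HasDoubleZero e (fun u => f u + x * g u) (z k)}) fun k => ?_).subset ?_
  · refine Set.Subsingleton.finite fun x hx y hy => ?_
    by_contra hxy
    have hyx : y - x ≠ 0 := sub_ne_zero.mpr (Ne.symm hxy)
    obtain ⟨p, hp, hp'⟩ := hx
    obtain ⟨q, hq, hq'⟩ := hy
    refine not_hasDoubleZero_prod ht (z k) ⟨_, (((hp.const_mul y).sub (hq.const_mul x)).const_mul
      (y - x)⁻¹), fun u => ?_⟩
    simp only [← hft]
    field_simp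
    linear_combination y * hp' u - x * hq' u
  · rintro x ⟨s, hs, hx⟩
    have h0 := bezoutian_self_eq_zero hG H hs hx
    have h0' := (hD' s).symm.trans h0
    obtain ⟨k, hk⟩ : ∃ k, bracket (z k) s = 0 := by
      simpa [hc, Finset.prod_eq_zero_iff] using h0'
    obtain ⟨b, rfl⟩ := exists_smul_of_bracket_eq_zero (hz k) hk
    exact Set.mem_iUnion.mpr ⟨k, hx.of_smul⟩

end Pencil

/-! ### The family -/

namespace TangentParametrization

variable {K : Type*} [Field K] [IsAlgClosed K] {Γ : PlaneCurve K 2}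

/-- The pairs of distinct tangents are Zariski dense: no curve contains all their intersections. -/
lemma exists_eval_pt_ne_zero (τ : TangentParametrization Γ) {d : ℕ} (C : PlaneCurve K d) :
    ∃ u v, bracket u v * MvPolynomial.eval (τ.pt u v) C.eqn ≠ 0 := by
  by_contra! h
  have hmul : Γ.eqn * C.eqn = 0 := τ.eq_of_eval_pt fun u v => by
    rw [map_mul, τ.eval_pt, map_zero, sq, mul_assoc, h, mul_zero]
  exact mul_ne_zero Γ.eqn_ne_zero C.eqn_ne_zero hmul

lemma exists_family (τ : TangentParametrization Γ) (h2 : (2 : K) ≠ 0) {e : ℕ}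
    (C : PlaneCurve K (e + 1)) (L : PlaneCurve K (e + 2))
    (hL : IsGeneralLateral L) (hLC : IsInscribedIn L C)
    (hLΓ : IsCircumscribedAbout L Γ) :
    ∃ F : Set (PlaneCurve K (e + 2)), IsOneDimFamily F ∧
      (∀ M ∈ F, IsGeneralLateral M ∧ IsInscribedIn M C ∧ IsCircumscribedAbout M Γ) ∧
      {p ∈ C.points | ¬ ∃ M ∈ F, p ∈ vertices M}.Finite ∧
      (∀ p ∈ C.points, ∃ M ∈ closure F, p ∈ limitVertices M Γ) := by
  obtain ⟨t, ht0, ht, hLt⟩ := τ.exists_isLateralOf hL hLΓ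
  obtain ⟨G, hGdef⟩ : ∃ G : (Fin 2 → K) → (Fin 2 → K) → K,
    ∀ u v, G u v = MvPolynomial.eval (τ.pt u v) C.eqn := ⟨_, fun _ _ => rfl⟩
  obtain ⟨f, hft⟩ : ∃ f : (Fin 2 → K) → K, ∀ u, f u = ∏ i, bracket (t i) u := ⟨_, fun _ => rfl⟩
  have hLf : τ.IsLateralOf L f := by rwa [funext hft]
  have hf : IsBinaryForm (e + 2) f := by
    rw [funext hft]; exact IsBinaryForm.prod fun i => IsBinaryForm.bracket_left _
  have hf0 : ∀ i, f (t i) = 0 := fun i => by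
    rw [hft]; exact Finset.prod_eq_zero (Finset.mem_univ i) (bracket_self _)
  have hsymm : ∀ u v, G u v = G v u := fun u v => by rw [hGdef, hGdef, τ.pt_comm]
  have hG : ∀ v, IsBinaryForm (e + 1) fun u => G u v := fun v => by
    simpa only [hGdef] using τ.isBinaryForm_eval_pt C.eqn_isHomogeneous v
  have hG' : ∀ v, IsBinaryForm (e + 1) (G v) := fun v => by
    have h := hG v
    simp only [fun u => hsymm u v] at h
    exact h
  have hC : ∀ {u v} (hu : u ≠ 0) (hv : v ≠ 0), τ.point hu hv ∈ C.points ↔ G u v = 0 :=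
    fun hu hv => by rw [hGdef]; exact τ.point_mem_points C hu hv
  have hGt : ∀ i j, i ≠ j → G (t i) (t j) = 0 := fun i j hij =>
    (hC (ht0 i) (ht0 j)).mp (hLC (hLf.mem_vertices hf _ _ (ht i j hij) (hf0 i) (hf0 j)))
  obtain ⟨a, ha⟩ := hLf.exists_ne_zero
  obtain ⟨g, hg, H⟩ := exists_bezoutian hsymm hG ht0 ht hGt hf hf0 ha
  obtain ⟨u₀, v₀, huv⟩ := τ.exists_eval_pt_ne_zero C
  rw [← hGdef] at huv
  have hfg : ∀ x y : K, (∀ u, x * f u + y * g u = 0) → x = 0 ∧ y = 0 := fun x y h => by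
    have hy : y = 0 := by
      have : y * (bracket u₀ v₀ * G u₀ v₀) = 0 := by
        rw [H]; linear_combination f u₀ * h v₀ - f v₀ * h u₀
      exact (mul_eq_zero.mp this).resolve_right huv
    refine ⟨?_, hy⟩
    simpa [hy, ha] using h a
  -- `Γ` is not contained in `C`: otherwise `G` would vanish on the grid of all `(t i, t j)`
  have hdiag : ∃ u, G u u ≠ 0 := by
    by_contra! h
    refine huv ?_
    rw [eq_zero_of_grid hsymm hG ht (fun i j => ?_) u₀ v₀, mul_zero]
    rcases eq_or_ne i j with rfl | hij
    exacts [h _, hGt i j hij]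
  have hD : IsBinaryForm (2 * (e + 1)) fun u => G u u := by
    simpa only [hGdef] using τ.isBinaryForm_eval_pt_self C.eqn_isHomogeneous
  set B : Set K := {x : K | ∃ s, s ≠ 0 ∧ HasDoubleZero e (fun u => f u + x * g u) s} with hB
  have hBfin : B.Finite := finite_setOf_hasDoubleZero ht hft hG' hD hdiag H
  obtain ⟨γ, δ, hγ, hδ, hγδ⟩ := τ.exists_pencil hf hg hfg
  obtain ⟨hF, hγF, hδF⟩ := hγδ B hBfin
  have hform : ∀ x, IsBinaryForm (e + 2) fun u => f u + x * g u := fun x => hf.add (hg.const_mul x)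
  -- every member of the pencil defines a lateral in the closure of the family
  have hmem : ∀ x y : K, x ≠ 0 ∨ y ≠ 0 → ∃ M, (M = δ ∨ ∃ z, M = γ z) ∧
      τ.IsLateralOf M (fun u => x * f u + y * g u) := fun x y hxy => by
    by_cases hx : x = 0
    · have hy : y ≠ 0 := hxy.resolve_left (not_not.mpr hx)
      obtain ⟨c, hc, hc'⟩ := hδ
      refine ⟨δ, Or.inl rfl, c * (y ^ 2)⁻¹, by simp [hc, hy], fun u v => ?_⟩
      rw [hc', hx]
      field_simp
      ring
    · obtain ⟨c, hc, hc'⟩ := hγ (y / x)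
      refine ⟨γ (y / x), Or.inr ⟨_, rfl⟩, c * (x ^ 2)⁻¹, by simp [hc, hx], fun u v => ?_⟩
      rw [hc']
      field_simp
  have hvert : ∀ {s u} (hs : s ≠ 0) (hu : u ≠ 0), bracket s u ≠ 0 → G s u = 0 →
      ∃ M, (M = δ ∨ ∃ z, M = γ z) ∧ τ.point hs hu ∈ vertices M := fun {s u} hs hu hsu h => by
    obtain ⟨x, y, hxy, h₁, h₂⟩ := exists_common_kernel (a := f s) (b := g s) (c := f u) (d := g u)
      (by rw [← H, h, mul_zero])
    obtain ⟨M, hM, hM'⟩ := hmem x y hxy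
    exact ⟨M, hM, hM'.mem_vertices ((hf.const_mul x).add (hg.const_mul y)) hs hu hsu h₁ h₂⟩
  have hdiagpt : ∀ {s u} (hs : s ≠ 0) (hu : u ≠ 0), bracket s u = 0 →
      τ.point hs hu = τ.point hs hs :=
    fun hs hu h => τ.point_eq_of_bracket hs hu hs hs (bracket_self _) h
  refine ⟨γ '' Bᶜ, hF, ?_, ?_, ?_⟩
  · rintro _ ⟨x, hx, rfl⟩
    refine ⟨(hγ x).isGeneralLateral (hform x) fun s hs h => hx ⟨s, hs, h⟩, ?_,
      (hγ x).isCircumscribedAbout h2 (hform x)⟩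
    intro p hp
    obtain ⟨s, u, hs, hu, hsu, h₁, h₂, rfl⟩ := (hγ x).exists_of_mem_vertices (hform x) hp
    rw [hC]
    have : bracket s u * G s u = 0 := by
      rw [H]; linear_combination g u * h₁ - g s * h₂
    exact (mul_eq_zero.mp this).resolve_left hsu
  · obtain ⟨c, hc, z, hz, hD'⟩ := hD.exists_factorization hdiag
    -- the exceptions: the points of `C ∩ Γ` and the vertices of the members left out of the family
    refine (((Set.finite_range fun k => τ.point (hz k) (hz k)).union
      (hδ.finite_vertices hg)).union (hBfin.biUnion fun x _ =>
        (hγ x).finite_vertices (hform x))).subset ?_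
    rintro p ⟨hp, hpF⟩
    obtain ⟨s, u, hs, hu, rfl⟩ := τ.exists_eq_point p
    by_cases hsu : bracket s u = 0
    · rw [hdiagpt hs hu hsu] at hp ⊢
      have h0 := (hD' s).symm.trans ((hC hs hs).mp hp)
      obtain ⟨k, hk⟩ : ∃ k, bracket (z k) s = 0 := by
        simpa [hc, Finset.prod_eq_zero_iff] using h0
      exact Or.inl (Or.inl ⟨k, (τ.point_eq_of_bracket hs hs (hz k) (hz k) hk hk).symm⟩)
    · obtain ⟨M, rfl | ⟨x, rfl⟩, hM⟩ := hvert hs hu hsu ((hC hs hu).mp hp)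
      · exact Or.inl (Or.inr hM)
      · by_cases hx : x ∈ B
        · exact Or.inr (Set.mem_biUnion hx hM)
        · exact absurd ⟨γ x, ⟨x, hx, rfl⟩, hM⟩ hpF
  · intro p hp
    have hcl : ∀ M, (M = δ ∨ ∃ z, M = γ z) → M ∈ closure (γ '' Bᶜ) := by
      rintro M (rfl | ⟨x, rfl⟩)
      exacts [hδF, hγF x]
    obtain ⟨s, u, hs, hu, rfl⟩ := τ.exists_eq_point p
    by_cases hsu : bracket s u = 0
    · rw [hdiagpt hs hu hsu] at hp ⊢
      obtain ⟨x, y, hxy, hd⟩ := exists_hasDoubleZero hf hg hG' H hs ((hC hs hs).mp hp)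
      obtain ⟨M, hM, hM'⟩ := hmem x y hxy
      exact ⟨M, hcl M hM, Or.inr ⟨τ.tanLine hs, hM'.lineForm_sq_dvd hs hd,
        τ.isTangentAt_tanLine h2 hs⟩⟩
    · obtain ⟨M, hM, hM'⟩ := hvert hs hu hsu ((hC hs hu).mp hp)
      exact ⟨M, hcl M hM, Or.inl hM'⟩

end TangentParametrization

end Darboux

theorem theorem3p2 {K : Type*} [Field K] [IsAlgClosed K] (h2 : (2 : K) ≠ 0)
    (n : ℕ) (hn : 1 ≤ n)
    (C : Darboux.PlaneCurve K n) (L : Darboux.PlaneCurve K (n + 1)) (Γ : Darboux.PlaneCurve K 2)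
    (hΓ : Irreducible Γ.eqn)
    (hL : Darboux.IsGeneralLateral L)
    (hLC : Darboux.IsInscribedIn L C)
    (hLΓ : Darboux.IsCircumscribedAbout L Γ) :
    ∃ F : Set (Darboux.PlaneCurve K (n + 1)),
      Darboux.IsOneDimFamily F ∧
      (∀ M ∈ F, Darboux.IsGeneralLateral M ∧ Darboux.IsInscribedIn M C ∧
        Darboux.IsCircumscribedAbout M Γ) ∧
      {p ∈ C.points | ¬ ∃ M ∈ F, p ∈ Darboux.vertices M}.Finite ∧
      (∀ p ∈ C.points, ∃ M ∈ closure F, p ∈ Darboux.limitVertices M Γ) := by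
  obtain ⟨τ⟩ := Darboux.exists_tangentParametrization h2 Γ hΓ
  obtain ⟨e, rfl⟩ : ∃ e, n = e + 1 := ⟨n - 1, by omega⟩
  exact τ.exists_family h2 C L hL hLC hLΓ
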